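/- **Setting.** Let $\mathcal X\subset\mathbb R^d$ be compact and convex, let $\|\cdot\|$ be a norm on $\mathbb R^d$ with dual norm $\|\cdot\|_*$, and let $\Phi:\mathcal C\to\mathbb R$ be convex on a convex set $\mathcal C\supseteq\mathcal X$ and differentiable at the points of $\mathcal X$, with Bregman divergence $D(x,y)=\Phi(x)-\Phi(y)-\nabla\Phi(y)^\top(x-y)$ satisfying $\|x-y\|^2\le D(x,y)\le R^2$ for all $x,y\in\mathcal X$. Let $\xi_1,\xi_2,\dots$ be a time-homogeneous ergodic (irreducible and aperiodic) Markov chain on a finite set $\mathcal S$, with arbitrary initial distribution, transition matrix $P$ and stationary distribution $\mu$. Put $$d_{\rm mix}(t)=\sup_\nu\|\nu P^t-\mu\|_{TV},\qquad \tau_{\rm mix}(\delta)=\min\{t\ge1: d_{\rm mix}(t)\le\delta\},\qquad \tau_{\rm mix}=\tau_{\rm mix}(1/4),\qquad \tau=\tau_{\rm mix}(1/T).$$ The constraint functions are $g_t(x)=g(x,\xi_t)$ where, for every $\xi\in\mathcal S$, $g(\cdot,\xi)$ is convex and differentiable on $\mathcal X$ with $\|\nabla g(x,\xi)\|_*\le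 G$ and $|g(x,\xi)|\le H$ for all $x\in\mathcal X$. Write $\bar g(x)=\mathbb E_{\xi\sim\mu}[g(x,\xi)]$ and assume Slater's condition: some $\hat x\in\mathcal X$ has $\bar g(\hat x)\le-\epsilon$, where $\epsilon>0$. For the loss functions $f_t$, which are convex and differentiable on $\mathcal X$ with $\|\nabla f_t(x)\|_*\le F$ for all $x\in\mathcal X$, there are two settings. * *Online convex optimization with ergodic constraints:* $f_1,\dots,f_T$ is an arbitrary fixed sequence. With $x^*\in\arg\min\{\sum_{t=1}^Tf_t(x): x\in\mathcal X,\ \bar g(x)\le0\}$, put $\mathrm{Regret}(T)=\sum_{t=1}^Tf_t(x_t)-\sum_{t=1}^Tf_t(x^*)$ and $\mathrm{Violation}(T)=\sum_{t=1}^Tg_t(x_t)$. * *Stochastic-constrained stochastic optimization:* $f_t(x)=f(x,\xi_t)$. With $\bar f(x)=\mathbb E_{\xi\sim\mu}[f(x,\xi)]$ and $x^\#\in\arg\min\{\bar f(x):x\in\mathcal X,\ \bar g(x)\le0\}$, put $\mathrm{Gap}(x)=\bar f(x)-\bar f(x^\#)$ and $\mathrm{Infeasibility}(x)=\bar g(x)$;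 $\mathrm{Violation}(T)$ is as above and $\mathrm{Regret}(T)=\sum_{t=1}^Tf_t(x_t)-\sum_{t=1}^Tf_t(x^\#)$. **Algorithm (ergodic drift-plus-penalty, $\beta=1/2$).** Start from a deterministic $x_1\in\mathcal X$ and $Q_1=0$. For $t=1,\dots,T$ put $V_t=(\tau_{\rm mix}t)^{1/2}$, $\alpha_t=\tau_{\rm mix}t$ and $$x_{t+1}=\arg\min_{x\in\mathcal X}\Big\{\big(V_t\nabla f_t(x_t)+Q_t\nabla g_t(x_t)\big)^\top x+\alpha_tD(x,x_t)\Big\},$$ $$Q_{t+1}=\max\Big\{Q_t+g_t(x_t)+\nabla g_t(x_t)^\top(x_{t+1}-x_t),\,0\Big\}.$$ Let $\bar x_T=\frac1T\sum_{t=1}^Tx_t$. **Theorem.** For all $R,F,G,H,\epsilon>0$ there is a constant $C>0$ depending only on $R,F,G,H,\epsilon$ such that the following holds for every instance as above and every $T\ge4$. In both settings $$\mathbb E[\mathrm{Regret}(T)]\le C\,\frac{\tau\sqrt T}{\sqrt{\tau_{\rm mix}}},\qquad \mathbb E[\mathrm{Violation}(T)]\le C\,\frac{\tau(\tau+T)}{\sqrt{\tau_{\rm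 mix}T}},$$ and in the setting of stochastic-constrained stochastic optimization also $$\mathbb E[\mathrm{Gap}(\bar x_T)]\le C\left(\frac{\tau^2}{\tau_{\rm mix}^{3/2}\sqrt T}+\frac{\tau^{5/2}}{\tau_{\rm mix}^{3/2}T}\right),$$ $$\mathbb E[\mathrm{Infeasibility}(\bar x_T)]\le C\left(\frac{\tau^2}{\tau_{\rm mix}^{3/2}\sqrt T}+\frac{\tau^{5/2}}{\tau_{\rm mix}^{3/2}T}+\frac{\tau^2}{\tau_{\rm mix}^{1/2}T^{3/2}}\right).$$ -/

import Mathlib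

open MeasureTheory
open scoped Matrix

universe u v w

noncomputable section

namespace EDPP

/-! ### Finite-state Markov chains and mixing times -/

section MarkovChain

variable {S : Type v} [Fintype S]

/-- Total variation distance of two distributions (probability vectors) on a finite set:
the supremum over all events `A` of `|p(A) - q(A)|`. -/
def tvDist (p q : S → ℝ) : ℝ :=
  ⨆ A : Finset S, |∑ s ∈ A, p s - ∑ s ∈ A, q s|

/-- `π` is a stationary distribution of the transition matrix `K`. -/
structure IsStationary (K : Matrix S S ℝ) (π : S → ℝ) : Prop where
  mem_simplex : π ∈ stdSimplex ℝ S
  stationary : π ᵥ* K = π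

/-- Expectation of `h` under the distribution `π` on the finite set `S`. -/
def mean (π : S → ℝ) (h : S → ℝ) : ℝ := ∑ s, π s * h s

variable [DecidableEq S]

/-- `K` is the transition matrix of an ergodic chain on a finite state space: it is stochastic,
irreducible, and aperiodic (for each state, the greatest common divisor of the possible return
times is `1`). -/
structure IsErgodic (K : Matrix S S ℝ) : Prop where
  stochastic : K ∈ Matrix.rowStochastic ℝ S
  irreducible : K.IsIrreducible
  aperiodic : ∀ s : S, ∀ d : ℕ, (∀ n : ℕ, 0 < n → 0 < (K ^ n) s s → d ∣ n) → d = 1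

/-- `d_mix(t)`: the largest distance to `π`, over all initial distributions `ν`, of the
distribution `ν K ^ t` after `t` steps. -/
def dMix (K : Matrix S S ℝ) (π : S → ℝ) (t : ℕ) : ℝ :=
  ⨆ ν : stdSimplex ℝ S, tvDist ((ν : S → ℝ) ᵥ* K ^ t) π

/-- `τ_mix(δ)`: the least positive integer `t` with `d_mix(t) ≤ δ`. -/
def tauMix (K : Matrix S S ℝ) (π : S → ℝ) (δ : ℝ) : ℕ :=
  sInf {t : ℕ | 1 ≤ t ∧ dMix K π t ≤ δ}

/-- `ξ 1, ξ 2, …` is a time-homogeneous Markov chain with transition matrix `K`; its initial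
distribution is arbitrary, and `ξ 0` is not used. -/
structure IsMarkovChain [MeasurableSpace S] {Ω : Type w} [MeasurableSpace Ω] (P : Measure Ω)
    (K : Matrix S S ℝ) (ξ : ℕ → Ω → S) : Prop where
  measurable : ∀ t, 1 ≤ t → Measurable (ξ t)
  markov : ∀ t, 1 ≤ t → ∀ s : ℕ → S,
    P.real {ω | ∀ i ∈ Finset.Icc 1 (t + 1), ξ i ω = s i} =
      P.real {ω | ∀ i ∈ Finset.Icc 1 t, ξ i ω = s i} * K (s t) (s (t + 1))

end MarkovChain

/-! ### Convex functions, mirror maps and constrained minimizers -/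

section Convex

variable {E : Type u} [NormedAddCommGroup E] [NormedSpace ℝ E]

/-- `h` is convex and differentiable on `X`, and `h'` is its gradient (as a linear functional). -/
structure IsDiffConvexOn (X : Set E) (h : E → ℝ) (h' : E → E →L[ℝ] ℝ) : Prop where
  convexOn : ConvexOn ℝ X h
  hasGradient : ∀ x ∈ X, HasFDerivWithinAt h (h' x) X x

/-- The Bregman divergence `D(x, y) = Φ(x) - Φ(y) - ∇Φ(y)ᵀ(x - y)`. -/
def bregman (Φ : E → ℝ) (Φ' : E → E →L[ℝ] ℝ) (x y : E) : ℝ :=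
  Φ x - Φ y - Φ' y (x - y)

/-- `Φ` is a convex function on the convex domain `D ⊇ X`, differentiable at the points of `X`
with gradient `Φ'`, it is `2`-strongly convex on `X`, and its Bregman divergence is at most `R²`
on `X`. -/
structure IsMirrorMap (X D : Set E) (Φ : E → ℝ) (Φ' : E → E →L[ℝ] ℝ) (R : ℝ) : Prop where
  convex_domain : Convex ℝ D
  subset_domain : X ⊆ D
  convexOn : ConvexOn ℝ D Φ
  hasGradient : ∀ y ∈ X, HasFDerivWithinAt Φ (Φ' y) D y
  bounded : ∀ x ∈ X, ∀ y ∈ X, bregman Φ Φ' x y ≤ R ^ 2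
  strong : ∀ x ∈ X, ∀ y ∈ X, ‖x - y‖ ^ 2 ≤ bregman Φ Φ' x y

/-- `z` minimizes `h` over the points `x ∈ X` with `c x ≤ 0`. -/
def IsConstrainedMin (X : Set E) (h c : E → ℝ) (z : E) : Prop :=
  z ∈ X ∧ c z ≤ 0 ∧ ∀ x ∈ X, c x ≤ 0 → h z ≤ h x

/-! ### The algorithm -/

/-- The penalty parameter `V_t = (τ_mix t) ^ β`. -/
def penalty (m : ℕ) (β : ℝ) (t : ℕ) : ℝ := ((m : ℝ) * (t : ℝ)) ^ β

/-- The step size parameter `α_t = τ_mix t`. -/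
def stepSize (m : ℕ) (t : ℕ) : ℝ := (m : ℝ) * (t : ℝ)

/-- `x 1, …, x (T + 1)` and `Q 1, …, Q (T + 1)` are the iterates and the virtual queue of the
ergodic drift-plus-penalty algorithm with `τ_mix = m`, run for `T` steps from `x₁` on the
observed loss functions with gradients `f' t` and constraint functions `g t` with gradients
`g' t`. -/
structure IsRun (X : Set E) (Φ : E → ℝ) (Φ' : E → E →L[ℝ] ℝ) (m : ℕ) (β : ℝ) (T : ℕ) (x₁ : E)
    (f' : ℕ → E → E →L[ℝ] ℝ) (g : ℕ → E → ℝ) (g' : ℕ → E → E →L[ℝ] ℝ)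
    (x : ℕ → E) (Q : ℕ → ℝ) : Prop where
  init_x : x 1 = x₁
  init_Q : Q 1 = 0
  primal_mem : ∀ t ∈ Finset.Icc 1 T, x (t + 1) ∈ X
  primal_min : ∀ t ∈ Finset.Icc 1 T,
    IsMinOn (fun y => (penalty m β t • f' t (x t) + Q t • g' t (x t)) y
      + stepSize m t * bregman Φ Φ' y (x t)) X (x (t + 1))
  dual : ∀ t ∈ Finset.Icc 1 T,
    Q (t + 1) = max (Q t + g t (x t) + g' t (x t) (x (t + 1) - x t)) 0

/-- The average of `x 1, …, x T`. -/
def average (x : ℕ → E) (T : ℕ) : E := (1 / (T : ℝ)) • ∑ t ∈ Finset.Icc 1 T, x t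

end Convex

/-- The random variable `Y` has a (well-defined) expectation, and it is at most `b`. -/
def ExpectationLE {Ω : Type w} [MeasurableSpace Ω] (P : Measure Ω) (Y : Ω → ℝ) (b : ℝ) : Prop :=
  Integrable Y P ∧ ∫ ω, Y ω ∂P ≤ b

end EDPP

end

noncomputable section

set_option linter.unusedSectionVars false

namespace EDPP

/-! ### Convergence of ergodic chains -/

section Mixing

variable {S : Type v} [Fintype S]

/-! Write `m` for the mixing time, `V = √(m t)` for the penalty and `V ^ 2` for the step size.
Pathwise, the three-point inequality for the mirror step together with convexity gives the
drift-plus-penalty inequality (`drift_plus_penalty`): for every `y ∈ X`, penalized regret plus half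
the increase of `Q ^ 2` is at most `Q t * g t y`, plus a weighted difference of divergences, plus a
constant. Dividing by `V` and summing by parts bounds the regret (`regret_le`), the violation is
controlled by the last queue length and the movement of the iterates (`violation_le`), and each
movement is of order `1 / V + Q / V ^ 2` (`norm_step_le`). What remains is probabilistic.

Regret needs `E[Q t * g t y]` for `y` feasible in stationary mean. The queue is correlated with the
current state, so it is replaced by the queue `τ` steps earlier. The change is `O(τ)`, and after `τ`
steps the chain is within `1 / T` of stationarity whatever its past, while `Q = O(T)`; hence the
expectation is `O(τ)` (`integral_Q_mul_le`).

Violation needs `E[Q t] = O(τ √t / √m)` (`integral_Q_le`). Over a window of length `s` of order `√(m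
t) + τ`, Slater's point gives the queue an expected drift of at most `-ε s / 8` as soon as it
exceeds a constant multiple of `s`: such a window is long enough both to mix and to dominate the
penalty. A Foster-Lyapunov argument for `exp (κ Q / s)` then bounds the exponential moment uniformly
(`integral_exp_le`).

For the averaged iterate, Jensen reduces to stationary means at the iterates. Freezing `x t` and
observing the chain `τ` steps later replaces the stationary mean by an observed value, at the price
of the movement over `τ` steps (`integral_mean_iterate_le`); the regret and violation bounds then
apply (`integral_mean_average_le`). -/

theorem abs_sum_sub_le_tvDist (p q : S → ℝ) (A : Finset S) :
    |∑ s ∈ A, p s - ∑ s ∈ A, q s| ≤ tvDist p q :=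
  le_ciSup (f := fun A : Finset S => |∑ s ∈ A, p s - ∑ s ∈ A, q s|)
    (Set.finite_range _).bddAbove A

theorem tvDist_le_sum_abs (p q : S → ℝ) : tvDist p q ≤ ∑ s, |p s - q s| := by
  refine ciSup_le fun A => ?_
  rw [← Finset.sum_sub_distrib]
  exact (Finset.abs_sum_le_sum_abs _ _).trans
    (Finset.sum_le_sum_of_subset_of_nonneg (Finset.subset_univ A) fun _ _ _ => abs_nonneg _)

/-- The sets where `p - q` is nonnegative and where it is negative are both admissible events, and
each carries one part of the `ℓ¹` distance. -/
theorem sum_abs_le_two_mul_tvDist (p q : S → ℝ) : ∑ s, |p s - q s| ≤ 2 * tvDist p q := by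
  classical
  rw [← Finset.sum_filter_add_sum_filter_not Finset.univ (fun s => q s ≤ p s)]
  have h1 : ∑ s with q s ≤ p s, |p s - q s| ≤ tvDist p q := by
    refine le_trans (le_of_eq ?_)
      ((le_abs_self _).trans (abs_sum_sub_le_tvDist p q {s | q s ≤ p s}))
    rw [← Finset.sum_sub_distrib]
    refine Finset.sum_congr rfl fun s hs => abs_of_nonneg ?_
    linarith [(Finset.mem_filter.1 hs).2]
  have h2 : ∑ s with ¬ q s ≤ p s, |p s - q s| ≤ tvDist p q := by
    refine le_trans (le_of_eq ?_)
      ((neg_le_abs _).trans (abs_sum_sub_le_tvDist p q {s | ¬ q s ≤ p s}))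
    rw [← Finset.sum_sub_distrib, ← Finset.sum_neg_distrib]
    refine Finset.sum_congr rfl fun s hs => abs_of_nonpos ?_
    linarith [not_le.1 (Finset.mem_filter.1 hs).2]
  linarith

theorem sum_abs_sub_le_two {p q : S → ℝ} (hp : p ∈ stdSimplex ℝ S) (hq : q ∈ stdSimplex ℝ S) :
    ∑ s, |p s - q s| ≤ 2 := by
  have : ∑ s, |p s - q s| ≤ ∑ s, (p s + q s) := Finset.sum_le_sum fun s _ => by
    have := hp.1 s
    have := hq.1 s
    exact abs_le.2 ⟨by linarith, by linarith⟩
  rw [Finset.sum_add_distrib, hp.2, hq.2] at this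
  linarith

variable [DecidableEq S]

theorem vecMul_mem_stdSimplex {A : Matrix S S ℝ} (hA : A ∈ Matrix.rowStochastic ℝ S)
    {p : S → ℝ} (hp : p ∈ stdSimplex ℝ S) : p ᵥ* A ∈ stdSimplex ℝ S := by
  refine ⟨Matrix.nonneg_vecMul_of_mem_rowStochastic hA hp.1, ?_⟩
  have := Matrix.vecMul_dotProduct_one_eq_one_rowStochastic hA (x := p)
    (by simpa [dotProduct] using hp.2)
  simpa [dotProduct] using this

/-- A stochastic matrix whose entries are all at least `c` contracts the `ℓ¹` norm of vectors of
total mass zero. -/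
theorem sum_abs_vecMul_le {A : Matrix S S ℝ} (hA : A ∈ Matrix.rowStochastic ℝ S) {c : ℝ}
    (hc : ∀ a b, c ≤ A a b) {p : S → ℝ} (hp : ∑ s, p s = 0) :
    ∑ b, |(p ᵥ* A) b| ≤ (1 - Fintype.card S * c) * ∑ a, |p a| := by
  have h1 : ∀ b, |(p ᵥ* A) b| ≤ ∑ a, |p a| * (A a b - c) := fun b => by
    -- Since `p` has total mass zero, subtracting `c` from every entry changes nothing. The
    -- remaining entries are nonnegative with row sums `1 - card S * c`, which is the contraction
    -- factor.
    have : (p ᵥ* A) b = ∑ a, p a * (A a b - c) := by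
      simp only [Matrix.vecMul, dotProduct, mul_sub, Finset.sum_sub_distrib, ← Finset.sum_mul, hp]
      ring
    rw [this]
    refine (Finset.abs_sum_le_sum_abs _ _).trans (le_of_eq (Finset.sum_congr rfl fun a _ => ?_))
    rw [abs_mul, abs_of_nonneg (sub_nonneg.2 (hc a b))]
  refine (Finset.sum_le_sum fun b _ => h1 b).trans (le_of_eq ?_)
  rw [Finset.sum_comm, Finset.mul_sum]
  refine Finset.sum_congr rfl fun a _ => ?_
  rw [← Finset.mul_sum, Finset.sum_sub_distrib, Matrix.sum_row_of_mem_rowStochastic hA]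
  simp
  ring

variable {K : Matrix S S ℝ} {π : S → ℝ}

theorem IsErgodic.pow_mem (hK : IsErgodic K) (n : ℕ) : K ^ n ∈ Matrix.rowStochastic ℝ S :=
  Submonoid.pow_mem _ hK.stochastic n

theorem IsErgodic.pow_nonneg (hK : IsErgodic K) (n : ℕ) (a b : S) : 0 ≤ (K ^ n) a b :=
  (hK.pow_mem n).1 a b

theorem IsErgodic.pow_add_pos (hK : IsErgodic K) {k l : ℕ} {a b c : S}
    (h1 : 0 < (K ^ k) a b) (h2 : 0 < (K ^ l) b c) : 0 < (K ^ (k + l)) a c := by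
  rw [pow_add, Matrix.mul_apply]
  exact (mul_pos h1 h2).trans_le (Finset.single_le_sum
    (f := fun j => (K ^ k) a j * (K ^ l) j c)
    (fun j _ => mul_nonneg (hK.pow_nonneg _ _ _) (hK.pow_nonneg _ _ _)) (Finset.mem_univ b))

/-- The return times to `a` are closed under addition and have gcd `1`, so they contain all large
integers. -/
theorem IsErgodic.exists_forall_ge_self_pos (hK : IsErgodic K) (a : S) :
    ∃ N, ∀ n, N ≤ n → 0 < (K ^ n) a a := by
  set s : Set ℕ := {n | 0 < n ∧ 0 < (K ^ n) a a} with hs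
  have hgcd : Nat.setGcd s = 1 :=
    hK.aperiodic a _ fun n hn hpos => Nat.setGcd_dvd_of_mem ⟨hn, hpos⟩
  obtain ⟨N, hN⟩ := Nat.exists_mem_closure_of_ge s
  refine ⟨N, fun n hn => ?_⟩
  refine AddSubmonoid.closure_induction (motive := fun n _ => 0 < (K ^ n) a a)
    (fun x hx => hx.2) (by simp) (fun x y _ _ hx hy => hK.pow_add_pos hx hy)
    (hN n hn (by rw [hgcd]; exact one_dvd n))

/-- A single exponent serves all pairs: it is large enough to loop at `a` for the time left over
after reserving `k a b` steps to travel from `a` to `b`. -/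
theorem IsErgodic.exists_pow_pos (hK : IsErgodic K) : ∃ N, ∀ a b, 0 < (K ^ N) a b := by
  choose M hM using hK.exists_forall_ge_self_pos
  have hir := (Matrix.isIrreducible_iff_exists_pow_pos fun a b => hK.irreducible.nonneg a b).1
    hK.irreducible
  choose k _ hk using hir
  refine ⟨∑ a, M a + ∑ a, ∑ b, k a b, fun a b => ?_⟩
  have h1 : M a ≤ ∑ a, M a := Finset.single_le_sum (fun _ _ => Nat.zero_le _) (Finset.mem_univ a)
  have h2 : k a b ≤ ∑ a, ∑ b, k a b :=
    (Finset.single_le_sum (f := fun b => k a b) (fun _ _ => Nat.zero_le _)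
      (Finset.mem_univ b)).trans
    (Finset.single_le_sum (f := fun a => ∑ b, k a b) (fun _ _ => Nat.zero_le _)
      (Finset.mem_univ a))
  have h3 : ∑ a, M a + ∑ a, ∑ b, k a b
      = (∑ a, M a + ∑ a, ∑ b, k a b - k a b) + k a b := by omega
  rw [h3]
  exact hK.pow_add_pos (hM a _ (by omega)) (hk a b)

theorem IsStationary.vecMul_pow (hπ : IsStationary K π) (n : ℕ) : π ᵥ* K ^ n = π := by
  induction n with
  | zero => simp
  | succ n ih => rw [pow_succ, ← Matrix.vecMul_vecMul, ih, hπ.stationary]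

theorem tvDist_le_dMix (hK : IsErgodic K) (hπ : IsStationary K π) (t : ℕ) {ν : S → ℝ}
    (hν : ν ∈ stdSimplex ℝ S) : tvDist (ν ᵥ* K ^ t) π ≤ dMix K π t := by
  refine le_ciSup (f := fun ν : stdSimplex ℝ S => tvDist ((ν : S → ℝ) ᵥ* K ^ t) π)
    ⟨2, ?_⟩ ⟨ν, hν⟩
  rintro _ ⟨ν, rfl⟩
  exact (tvDist_le_sum_abs _ _).trans
    (sum_abs_sub_le_two (vecMul_mem_stdSimplex (hK.pow_mem t) ν.2) hπ.mem_simplex)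

theorem IsStationary.nonempty (hπ : IsStationary K π) : Nonempty S := by
  by_contra h
  rw [not_nonempty_iff] at h
  have := hπ.mem_simplex.2
  simp at this

theorem dMix_antitone (hK : IsErgodic K) (hπ : IsStationary K π) : Antitone (dMix K π) := by
  intro t t' h
  have : Nonempty (stdSimplex ℝ S) := ⟨⟨π, hπ.mem_simplex⟩⟩
  refine ciSup_le fun ν => ?_
  obtain ⟨k, rfl⟩ := Nat.exists_eq_add_of_le' h
  rw [pow_add, ← Matrix.vecMul_vecMul]
  exact tvDist_le_dMix hK hπ t (vecMul_mem_stdSimplex (hK.pow_mem k) ν.2)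

/-- Doeblin's argument: a power of the matrix has all entries at least `c > 0`, so it contracts `ℓ¹`
distances to the stationary law geometrically. It ensures that the infimum defining `tauMix` is over
a nonempty set, hence attained. -/
theorem exists_dMix_le (hK : IsErgodic K) (hπ : IsStationary K π) {δ : ℝ} (hδ : 0 < δ) :
    ∃ t, 1 ≤ t ∧ dMix K π t ≤ δ := by
  have hS := hπ.nonempty
  have : Nonempty (stdSimplex ℝ S) := ⟨⟨π, hπ.mem_simplex⟩⟩
  obtain ⟨N, hN⟩ := hK.exists_pow_pos
  obtain ⟨⟨a₀, b₀⟩, hmin⟩ := Finite.exists_min fun ab : S × S => (K ^ N) ab.1 ab.2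
  set c := (K ^ N) a₀ b₀ with hc
  have hc0 : 0 < c := hN _ _
  have hcard : (1 : ℝ) ≤ Fintype.card S := by exact_mod_cast Fintype.card_pos
  set ρ := 1 - Fintype.card S * c with hρ
  have hρ1 : ρ < 1 := by
    have : 0 < Fintype.card S * c := by positivity
    linarith
  have hρ0 : 0 ≤ ρ := by
    have h := Matrix.sum_row_of_mem_rowStochastic (hK.pow_mem N) a₀
    have h2 : ∑ _j : S, c ≤ ∑ j, (K ^ N) a₀ j := Finset.sum_le_sum fun j _ => hmin (a₀, j)
    rw [h] at h2
    simp at h2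
    linarith
  have key : ∀ k : ℕ, ∀ ν ∈ stdSimplex ℝ S,
      ∑ s, |(ν ᵥ* K ^ (N * k)) s - π s| ≤ ρ ^ k * 2 := by
    intro k
    induction k with
    | zero => intro ν hν; simpa using sum_abs_sub_le_two hν hπ.mem_simplex
    | succ k ih =>
      intro ν hν
      have h1 := sum_abs_vecMul_le (hK.pow_mem N) (fun a b => hmin (a, b))
        (p := ν ᵥ* K ^ (N * k) - π) (by
          simp only [Pi.sub_apply, Finset.sum_sub_distrib, hπ.mem_simplex.2,
            (vecMul_mem_stdSimplex (hK.pow_mem (N * k)) hν).2, sub_self])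
      rw [Matrix.sub_vecMul, hπ.vecMul_pow, Matrix.vecMul_vecMul, ← pow_add] at h1
      refine (h1.trans (mul_le_mul_of_nonneg_left (ih ν hν) hρ0)).trans (le_of_eq ?_)
      rw [pow_succ]
      ring
  obtain ⟨k, hk⟩ := exists_pow_lt_of_lt_one (show 0 < δ / 2 by linarith) hρ1
  -- The extra step only secures a positive time; monotonicity of `dMix` makes it harmless.
  refine ⟨N * k + 1, by omega, (dMix_antitone hK hπ (Nat.le_succ _)).trans ?_⟩
  refine ciSup_le fun ν => (tvDist_le_sum_abs _ _).trans ((key k ν ν.2).trans ?_)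
  linarith

theorem tauMix_spec (hK : IsErgodic K) (hπ : IsStationary K π) {δ : ℝ} (hδ : 0 < δ) :
    1 ≤ tauMix K π δ ∧ dMix K π (tauMix K π δ) ≤ δ :=
  Nat.sInf_mem (s := {t : ℕ | 1 ≤ t ∧ dMix K π t ≤ δ}) (exists_dMix_le hK hπ hδ)

theorem tauMix_anti (hK : IsErgodic K) (hπ : IsStationary K π) {δ δ' : ℝ} (hδ : 0 < δ)
    (h : δ ≤ δ') : tauMix K π δ' ≤ tauMix K π δ :=
  Nat.sInf_le ⟨(tauMix_spec hK hπ hδ).1, (tauMix_spec hK hπ hδ).2.trans h⟩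

/-- Mixing applied to the point mass at `a`, so the estimate is uniform in the current state. The
factor `2` converts total variation into `ℓ¹` distance. -/
theorem abs_pow_mulVec_sub_mean_le (hK : IsErgodic K) (hπ : IsStationary K π) {δ : ℝ} (hδ : 0 < δ)
    {j : ℕ} (hj : tauMix K π δ ≤ j) {h : S → ℝ} {B : ℝ} (hB : ∀ s, |h s| ≤ B) (a : S) :
    |(K ^ j *ᵥ h) a - mean π h| ≤ 2 * B * δ := by
  have hs := single_mem_stdSimplex ℝ a
  set p := (Pi.single a (1 : ℝ) : S → ℝ) ᵥ* K ^ j with hp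
  have htv : tvDist p π ≤ δ := (tvDist_le_dMix hK hπ j hs).trans
    ((dMix_antitone hK hπ hj).trans (tauMix_spec hK hπ hδ).2)
  have h1 : (K ^ j *ᵥ h) a = ∑ s, p s * h s := by
    simp [hp, Matrix.mulVec, dotProduct]
  have hB0 : 0 ≤ B := (abs_nonneg _).trans (hB a)
  rw [h1, mean, ← Finset.sum_sub_distrib]
  calc |∑ s, (p s * h s - π s * h s)| ≤ ∑ s, |p s * h s - π s * h s| :=
        Finset.abs_sum_le_sum_abs _ _
    _ ≤ ∑ s, |p s - π s| * B := Finset.sum_le_sum fun s _ => by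
        rw [← sub_mul, abs_mul]
        exact mul_le_mul_of_nonneg_left (hB s) (abs_nonneg _)
    _ = (∑ s, |p s - π s|) * B := by rw [Finset.sum_mul]
    _ ≤ (2 * tvDist p π) * B := mul_le_mul_of_nonneg_right (sum_abs_le_two_mul_tvDist _ _) hB0
    _ ≤ (2 * δ) * B := by gcongr
    _ = 2 * B * δ := by ring

theorem mean_le_of_forall_le (hπ : π ∈ stdSimplex ℝ S) {h : S → ℝ} {B : ℝ} (hB : ∀ s, h s ≤ B) :
    mean π h ≤ B :=
  calc mean π h ≤ ∑ s, π s * B :=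
        Finset.sum_le_sum fun s _ => mul_le_mul_of_nonneg_left (hB s) (hπ.1 s)
    _ = B := by rw [← Finset.sum_mul, hπ.2, one_mul]

end Mixing

/-! ### Expectations of functions of an initial segment of the chain -/

section Path

variable {S : Type v} {Ω : Type w} {β γ : Type*}

/-- `Y` is a function of `ξ 1, …, ξ t`. -/
def PathDep (ξ : ℕ → Ω → S) (t : ℕ) (Y : Ω → β) : Prop :=
  ∀ ω ω', (∀ i ∈ Finset.Icc 1 t, ξ i ω = ξ i ω') → Y ω = Y ω'

theorem PathDep.mono {ξ : ℕ → Ω → S} {t t' : ℕ} {Y : Ω → β} (h : PathDep ξ t Y) (ht : t ≤ t') :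
    PathDep ξ t' Y := fun ω ω' hω =>
  h ω ω' fun i hi => hω i (Finset.Icc_subset_Icc_right ht hi)

theorem PathDep.comp {ξ : ℕ → Ω → S} {t : ℕ} {Y : Ω → β} (h : PathDep ξ t Y) (f : β → γ) :
    PathDep ξ t fun ω => f (Y ω) := fun ω ω' hω => congrArg f (h ω ω' hω)

theorem PathDep.comp₂ {ξ : ℕ → Ω → S} {t : ℕ} {β' : Type*} {Y : Ω → β} {Z : Ω → β'}
    (hY : PathDep ξ t Y) (hZ : PathDep ξ t Z) (f : β → β' → γ) :
    PathDep ξ t fun ω => f (Y ω) (Z ω) := fun ω ω' hω =>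
  congrArg₂ f (hY ω ω' hω) (hZ ω ω' hω)

theorem pathDep_self {ξ : ℕ → Ω → S} {t : ℕ} (ht : 1 ≤ t) : PathDep ξ t (ξ t) :=
  fun _ _ h => h t (Finset.mem_Icc.2 ⟨ht, le_rfl⟩)

theorem PathDep.sum {ξ : ℕ → Ω → S} {t : ℕ} [AddCommMonoid β] {ι : Type*} {A : Finset ι}
    {Y : ι → Ω → β} (h : ∀ i ∈ A, PathDep ξ t (Y i)) : PathDep ξ t fun ω => ∑ i ∈ A, Y i ω :=
  fun ω ω' hω => Finset.sum_congr rfl fun i hi => h i hi ω ω' hω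

/-- The initial segment `ξ 1, …, ξ t` as a random element of a finite product. -/
def path (ξ : ℕ → Ω → S) (t : ℕ) (ω : Ω) : Finset.Icc 1 t → S := fun i => ξ i ω

theorem PathDep.exists_eq [Nonempty β] {ξ : ℕ → Ω → S} {t : ℕ} {Y : Ω → β} (h : PathDep ξ t Y) :
    ∃ y : (Finset.Icc 1 t → S) → β, ∀ ω, Y ω = y (path ξ t ω) := by
  have hf : Function.FactorsThrough Y (path ξ t) := fun ω ω' hω =>
    h ω ω' fun i hi => congrFun hω ⟨i, hi⟩
  exact ⟨Function.extend (path ξ t) Y (fun _ => Classical.arbitrary β),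
    fun ω => (hf.extend_apply _ ω).symm⟩

variable [Fintype S] [DecidableEq S] [MeasurableSpace S] [MeasurableSingletonClass S]
  [MeasurableSpace Ω] {P : Measure Ω} [IsProbabilityMeasure P] {K : Matrix S S ℝ} {ξ : ℕ → Ω → S}

theorem measurable_path (hξ : ∀ t, 1 ≤ t → Measurable (ξ t)) (t : ℕ) : Measurable (path ξ t) :=
  measurable_pi_lambda _ fun i => hξ i (Finset.mem_Icc.1 i.2).1

/-- `Y` factors through the path, which takes finitely many values; neither measurability nor
boundedness of `Y` has to be supplied. This provides every integrability claim about the iterates.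
-/
theorem IsMarkovChain.integrable (hξ : IsMarkovChain P K ξ) {t : ℕ} {Y : Ω → ℝ}
    (hY : PathDep ξ t Y) : Integrable Y P := by
  obtain ⟨y, hy⟩ := hY.exists_eq
  rw [show Y = y ∘ path ξ t from funext hy]
  have hm := measurable_path hξ.measurable t
  have : IsFiniteMeasure (P.map (path ξ t)) := inferInstance
  exact (Integrable.of_finite (μ := P.map (path ξ t)) (f := y)).comp_measurable hm

theorem IsMarkovChain.integral_mul_succ (hξ : IsMarkovChain P K ξ) {t : ℕ} (ht : 1 ≤ t)
    {Y : Ω → ℝ} (hY : PathDep ξ t Y) (h : S → ℝ) :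
    ∫ ω, Y ω * h (ξ (t + 1) ω) ∂P = ∫ ω, Y ω * (K *ᵥ h) (ξ t ω) ∂P := by
  obtain ⟨y, hy⟩ := hY.exists_eq
  have hm := measurable_path hξ.measurable t
  set l : Finset.Icc 1 t := ⟨t, Finset.mem_Icc.2 ⟨ht, le_rfl⟩⟩ with hl
  set A : (Finset.Icc 1 t → S) → Set Ω := fun p => path ξ t ⁻¹' {p} with hA
  have hAm : ∀ p, MeasurableSet (A p) := fun p => hm (measurableSet_singleton p)
  set B : S → Set Ω := fun a => ξ (t + 1) ⁻¹' {a} with hB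
  have hBm : ∀ a, MeasurableSet (B a) := fun a =>
    hξ.measurable (t + 1) (by omega) (measurableSet_singleton a)
  have h1 : ∀ ω, Y ω * h (ξ (t + 1) ω)
      = ∑ p, ∑ a, (A p ∩ B a).indicator (fun _ => y p * h a) ω := by
    intro ω
    rw [Finset.sum_eq_single (path ξ t ω), Finset.sum_eq_single (ξ (t + 1) ω)]
    · rw [Set.indicator_of_mem (by simp [hA, hB]), hy]
    · intro a _ ha
      exact Set.indicator_of_notMem (by simp [hB, Ne.symm ha]) _
    · simp
    · intro p _ hp
      refine Finset.sum_eq_zero fun a _ => Set.indicator_of_notMem (by simp [hA, Ne.symm hp]) _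
    · simp
  have h2 : ∀ ω, Y ω * (K *ᵥ h) (ξ t ω)
      = ∑ p, (A p).indicator (fun _ => y p * (K *ᵥ h) (p l)) ω := by
    intro ω
    rw [Finset.sum_eq_single (path ξ t ω)]
    · rw [Set.indicator_of_mem (by simp [hA]), hy]
      rfl
    · intro p _ hp
      exact Set.indicator_of_notMem (by simp [hA, Ne.symm hp]) _
    · simp
  simp only [h1, h2]
  have hi : ∀ p a, Integrable ((A p ∩ B a).indicator fun _ => y p * h a) P := fun p a =>
    (integrable_const _).indicator ((hAm p).inter (hBm a))
  rw [integral_finsetSum _ fun p _ => integrable_finsetSum _ fun a _ => hi p a,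
    integral_finsetSum _ fun p _ => (integrable_const _).indicator (hAm p)]
  refine Finset.sum_congr rfl fun p _ => ?_
  rw [integral_finsetSum _ fun a _ => hi p a, integral_indicator_const _ (hAm p)]
  simp only [fun a => integral_indicator_const (μ := P) (y p * h a) ((hAm p).inter (hBm a)),
    smul_eq_mul, Matrix.mulVec, dotProduct, Finset.mul_sum]
  refine Finset.sum_congr rfl fun a _ => ?_
  -- The trajectory that follows `p` up to time `t` and equals `a` afterwards; the Markov property
  -- along it gives the probability of the atom `A p ∩ B a`.
  have hmk := hξ.markov t ht
    (fun i => if hi : i ∈ Finset.Icc 1 t then p ⟨i, hi⟩ else a)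
  have e1 : {ω | ∀ i ∈ Finset.Icc 1 (t + 1), ξ i ω
      = if hi : i ∈ Finset.Icc 1 t then p ⟨i, hi⟩ else a} = A p ∩ B a := by
    ext ω
    simp only [Set.mem_ofPred_eq, Set.mem_inter_iff, hA, hB, Set.mem_preimage,
      Set.mem_singleton_iff]
    constructor
    · intro H
      refine ⟨funext fun i => ?_, ?_⟩
      · have := H i (Finset.Icc_subset_Icc_right (Nat.le_succ t) i.2)
        rwa [dif_pos i.2] at this
      · have := H (t + 1) (Finset.mem_Icc.2 ⟨by omega, le_rfl⟩)
        rwa [dif_neg (by simp)] at this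
    · rintro ⟨H1, H2⟩ i hi
      split_ifs with hi'
      · exact congrFun H1 ⟨i, hi'⟩
      · have : i = t + 1 := by
          simp only [Finset.mem_Icc] at hi hi'
          omega
        rw [this, H2]
  have e2 : {ω | ∀ i ∈ Finset.Icc 1 t, ξ i ω
      = if hi : i ∈ Finset.Icc 1 t then p ⟨i, hi⟩ else a} = A p := by
    ext ω
    simp only [Set.mem_ofPred_eq, hA, Set.mem_preimage, Set.mem_singleton_iff]
    constructor
    · intro H
      refine funext fun i => ?_
      have := H i i.2
      rwa [dif_pos i.2] at this
    · intro H1 i hi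
      rw [dif_pos hi]
      exact congrFun H1 ⟨i, hi⟩
  have e3 : (if hi : t ∈ Finset.Icc 1 t then p ⟨t, hi⟩ else a) = p l :=
    dif_pos l.2
  have e4 : (if hi : t + 1 ∈ Finset.Icc 1 t then p ⟨t + 1, hi⟩ else a) = a :=
    dif_neg (by simp)
  rw [e1, e2, e3, e4] at hmk
  rw [hmk]
  ring

theorem IsMarkovChain.integral_mul_add (hξ : IsMarkovChain P K ξ) {t : ℕ} (ht : 1 ≤ t)
    {Y : Ω → ℝ} (hY : PathDep ξ t Y) (j : ℕ) (h : S → ℝ) :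
    ∫ ω, Y ω * h (ξ (t + j) ω) ∂P = ∫ ω, Y ω * (K ^ j *ᵥ h) (ξ t ω) ∂P := by
  induction j generalizing h with
  | zero => simp
  | succ j ih =>
    rw [← add_assoc, hξ.integral_mul_succ (by omega) (hY.mono (Nat.le_add_right t j)), ih,
      Matrix.mulVec_mulVec, ← pow_succ]

variable {π : S → ℝ}

theorem IsMarkovChain.integral_mul_le (hξ : IsMarkovChain P K ξ) (hK : IsErgodic K)
    (hπ : IsStationary K π) {t j : ℕ} (ht : 1 ≤ t) {δ : ℝ} (hδ : 0 < δ) (hj : tauMix K π δ ≤ j)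
    {Y : Ω → ℝ} (hY : PathDep ξ t Y) (hY0 : ∀ ω, 0 ≤ Y ω) {h : S → ℝ} {B : ℝ}
    (hB : ∀ s, |h s| ≤ B) :
    ∫ ω, Y ω * h (ξ (t + j) ω) ∂P ≤ (mean π h + 2 * B * δ) * ∫ ω, Y ω ∂P := by
  rw [hξ.integral_mul_add ht hY, ← integral_const_mul]
  refine integral_mono (hξ.integrable (t := t) (hY.comp₂ (pathDep_self ht)
    fun a b => a * (K ^ j *ᵥ h) b)) ((hξ.integrable hY).const_mul _) fun ω => ?_
  have := abs_le.1 (abs_pow_mulVec_sub_mean_le hK hπ hδ hj hB (ξ t ω))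
  show Y ω * _ ≤ _ * Y ω
  rw [mul_comm]
  exact mul_le_mul_of_nonneg_right (by linarith [this.2]) (hY0 ω)

/-- After `j ≥ τ_mix(δ)` further steps a bounded function of the past and of the state of the
chain has nearly the expectation it has under an independent stationary state. -/
theorem IsMarkovChain.integral_mean_le (hξ : IsMarkovChain P K ξ) (hK : IsErgodic K)
    (hπ : IsStationary K π) {t j : ℕ} (ht : 1 ≤ t) {δ : ℝ} (hδ : 0 < δ) (hj : tauMix K π δ ≤ j)
    {Z : Ω → β} (hZ : PathDep ξ t Z) {h : β → S → ℝ} {B : ℝ} (hB : ∀ ω s, |h (Z ω) s| ≤ B) :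
    ∫ ω, mean π (h (Z ω)) ∂P ≤ ∫ ω, h (Z ω) (ξ (t + j) ω) ∂P + 2 * B * δ := by
  -- Expanding over the states separates the two sources of randomness: the coefficients `h (Z ω) s`
  -- depend on the past only, and the indicators on the future state.
  have e1 : ∀ ω, h (Z ω) (ξ (t + j) ω)
      = ∑ s, h (Z ω) s * (Pi.single s (1 : ℝ) : S → ℝ) (ξ (t + j) ω) := fun ω => by
    simp [Pi.single_apply]
  have d1 : ∀ s, PathDep ξ t fun ω => h (Z ω) s := fun s => hZ.comp fun z => h z s
  have e2 : ∫ ω, h (Z ω) (ξ (t + j) ω) ∂P = ∫ ω, (K ^ j *ᵥ h (Z ω)) (ξ t ω) ∂P := by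
    simp only [e1]
    rw [integral_finsetSum]
    · simp only [fun s => hξ.integral_mul_add ht (d1 s) j]
      rw [← integral_finsetSum]
      · refine integral_congr_ae (Filter.Eventually.of_forall fun ω => ?_)
        simp [Matrix.mulVec, dotProduct, Pi.single_apply, mul_comm]
      · exact fun s _ => hξ.integrable ((d1 s).comp₂ (pathDep_self ht)
          fun a b => a * (K ^ j *ᵥ Pi.single s 1) b)
    · exact fun s _ => hξ.integrable (((d1 s).mono (Nat.le_add_right t j)).comp₂
        (pathDep_self (by omega)) fun a b => a * (Pi.single s (1 : ℝ) : S → ℝ) b)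
  rw [e2]
  have i1 : Integrable (fun ω => mean π (h (Z ω))) P :=
    hξ.integrable (hZ.comp fun z => mean π (h z))
  have i2 : Integrable (fun ω => (K ^ j *ᵥ h (Z ω)) (ξ t ω)) P :=
    hξ.integrable (hZ.comp₂ (pathDep_self ht) fun z s => (K ^ j *ᵥ h z) s)
  have : ∫ ω, mean π (h (Z ω)) ∂P ≤ ∫ ω, ((K ^ j *ᵥ h (Z ω)) (ξ t ω) + 2 * B * δ) ∂P :=
    integral_mono i1 (i2.add (integrable_const _)) fun ω => by
      have := abs_le.1 (abs_pow_mulVec_sub_mean_le hK hπ hδ hj (hB ω) (ξ t ω))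
      show _ ≤ _ + _
      linarith [this.1]
  rwa [integral_add i2 (integrable_const _), integral_const, probReal_univ, one_smul] at this

end Path

/-! ### Mirror descent steps -/

section Deterministic

variable {E : Type u} [NormedAddCommGroup E] [NormedSpace ℝ E]

/-- The gradient is taken only within `X`, whose interior may be empty, so the first-order
inequality is derived on the segment from `x` to `y`, with a one-sided derivative at `x`. -/
theorem IsDiffConvexOn.add_le {X : Set E} {f : E → ℝ} {f' : E → E →L[ℝ] ℝ}
    (hf : IsDiffConvexOn X f f') {x y : E} (hx : x ∈ X) (hy : y ∈ X) :
    f x + f' x (y - x) ≤ f y := by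
  set L : ℝ → E := ⇑(AffineMap.lineMap x y : ℝ →ᵃ[ℝ] E) with hL
  have hmaps : Set.MapsTo L (Set.Icc 0 1) X := fun t ht =>
    hf.convexOn.1.lineMap_mem hx hy ht
  have hconv : ConvexOn ℝ (Set.Icc (0 : ℝ) 1) (f ∘ L) :=
    (hf.convexOn.comp_affineMap (AffineMap.lineMap x y : ℝ →ᵃ[ℝ] E)).subset hmaps (convex_Icc 0 1)
  have hder : HasDerivWithinAt (f ∘ L) (f' x (y - x)) (Set.Icc 0 1) 0 := by
    have h0 : L 0 = x := AffineMap.lineMap_apply_zero x y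
    have h1 : HasFDerivWithinAt f (f' x) X (L 0) := by rw [h0]; exact hf.hasGradient x hx
    exact h1.comp_hasDerivWithinAt 0 AffineMap.hasDerivWithinAt_lineMap hmaps
  have := hconv.le_slope_of_hasDerivWithinAt (Set.left_mem_Icc.2 zero_le_one)
    (Set.right_mem_Icc.2 zero_le_one) zero_lt_one hder
  simp [slope_def_field, hL] at this
  linarith [map_sub (f' x) y x]

theorem IsDiffConvexOn.sub_le {X : Set E} {f : E → ℝ} {f' : E → E →L[ℝ] ℝ}
    (hf : IsDiffConvexOn X f f') {L : ℝ} (hL : ∀ y ∈ X, ‖f' y‖ ≤ L) {x y : E} (hx : x ∈ X)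
    (hy : y ∈ X) : f x - f y ≤ L * ‖x - y‖ := by
  have h1 := hf.add_le hx hy
  have h2 : f' x (x - y) ≤ L * ‖x - y‖ :=
    (le_abs_self _).trans (((f' x).le_opNorm _).trans
      (mul_le_mul_of_nonneg_right (hL x hx) (norm_nonneg _)))
  have h3 : f' x (y - x) = - f' x (x - y) := by rw [← map_neg, neg_sub]
  linarith

theorem IsDiffConvexOn.sub_const {X : Set E} {f : E → ℝ} {f' : E → E →L[ℝ] ℝ}
    (hf : IsDiffConvexOn X f f') (c : ℝ) : IsDiffConvexOn X (fun y => f y - c) f' where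
  convexOn := hf.convexOn.sub (concaveOn_const c hf.convexOn.1)
  hasGradient x hx := (hf.hasGradient x hx).sub_const c

variable {X D : Set E} {Φ : E → ℝ} {Φ' : E → E →L[ℝ] ℝ} {R : ℝ}

theorem IsMirrorMap.bregman_nonneg (hΦ : IsMirrorMap X D Φ Φ' R) {x y : E} (hx : x ∈ X)
    (hy : y ∈ X) : 0 ≤ bregman Φ Φ' x y :=
  (sq_nonneg _).trans (hΦ.strong x hx y hy)

theorem IsMirrorMap.norm_sub_le (hΦ : IsMirrorMap X D Φ Φ' R) (hR : 0 ≤ R) {x y : E} (hx : x ∈ X)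
    (hy : y ∈ X) : ‖x - y‖ ≤ R :=
  abs_le_of_sq_le_sq' ((hΦ.strong x hx y hy).trans (hΦ.bounded x hx y hy)) hR |>.2

theorem bregman_self (x : E) : bregman Φ Φ' x x = 0 := by simp [bregman]

/-- The three-point inequality for the minimizer of a linear functional plus a multiple of a
Bregman divergence. -/
theorem IsMirrorMap.add_le_of_isMinOn (hX : Convex ℝ X) (hΦ : IsMirrorMap X D Φ Φ' R)
    {l : E →L[ℝ] ℝ} {α : ℝ} {x z y : E} (hz : z ∈ X) (hy : y ∈ X)
    (hmin : IsMinOn (fun y => l y + α * bregman Φ Φ' y x) X z) :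
    l z + α * bregman Φ Φ' z x + α * bregman Φ Φ' y z ≤ l y + α * bregman Φ Φ' y x := by
  have hd : HasFDerivWithinAt (fun y => l y + α * bregman Φ Φ' y x)
      (l + α • (Φ' z - Φ' x)) X z := by
    refine l.hasFDerivWithinAt.add (HasFDerivWithinAt.const_mul ?_ α)
    have h1 := (hΦ.hasGradient z (hz)).mono hΦ.subset_domain
    have h2 : HasFDerivWithinAt (fun y => Φ' x (y - x)) (Φ' x) X z := by
      have := (Φ' x).hasFDerivWithinAt (s := X) (x := z) |>.sub_const (Φ' x x)
      simpa only [map_sub] using this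
    exact (h1.sub_const (Φ x)).sub h2
  -- First-order optimality in the feasible direction `y - z`. Combined with the identity `D(y,x) -
  -- D(z,x) - D(y,z) = (Φ' z - Φ' x)(y - z)`, it is the claim.
  have h := hmin.localize.hasFDerivWithinAt_nonneg hd
    (sub_mem_posTangentConeAt_of_segment_subset (hX.segment_subset hz hy))
  simp only [add_apply, smul_apply,
    sub_apply, smul_eq_mul, map_sub] at h
  simp only [bregman, map_sub]
  linarith

/-- Iterates of the algorithm with `β = 1/2` along one sequence of loss and constraint functions
satisfying the boundedness assumptions. -/
structure BoundedRun (X D : Set E) (Φ : E → ℝ) (Φ' : E → E →L[ℝ] ℝ) (R F G H : ℝ) (m T : ℕ)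
    (f : ℕ → E → ℝ) (f' : ℕ → E → E →L[ℝ] ℝ) (g : ℕ → E → ℝ) (g' : ℕ → E → E →L[ℝ] ℝ)
    (x : ℕ → E) (Q : ℕ → ℝ) : Prop where
  convex : Convex ℝ X
  mirror : IsMirrorMap X D Φ Φ' R
  loss : ∀ t ∈ Finset.Icc 1 T, IsDiffConvexOn X (f t) (f' t)
  loss_grad : ∀ t ∈ Finset.Icc 1 T, ∀ y ∈ X, ‖f' t y‖ ≤ F
  constr : ∀ t, IsDiffConvexOn X (g t) (g' t)
  constr_grad : ∀ t, ∀ y ∈ X, ‖g' t y‖ ≤ G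
  constr_bdd : ∀ t, ∀ y ∈ X, |g t y| ≤ H
  init_mem : x 1 ∈ X
  m_pos : 1 ≤ m
  R_nonneg : 0 ≤ R
  F_nonneg : 0 ≤ F
  G_nonneg : 0 ≤ G
  H_nonneg : 0 ≤ H
  run : IsRun X Φ Φ' m (1 / 2) T (x 1) f' g g' x Q

/-! ### Pathwise estimates for a single run. -/

namespace BoundedRun

variable {F G H : ℝ} {m T : ℕ} {f : ℕ → E → ℝ} {f' : ℕ → E → E →L[ℝ] ℝ} {g : ℕ → E → ℝ}
  {g' : ℕ → E → E →L[ℝ] ℝ} {x : ℕ → E} {Q : ℕ → ℝ}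

theorem mem (h : BoundedRun X D Φ Φ' R F G H m T f f' g g' x Q) {t : ℕ} (h1 : 1 ≤ t)
    (h2 : t ≤ T + 1) : x t ∈ X := by
  rcases Nat.lt_or_ge 1 t with h3 | h3
  · obtain ⟨k, rfl⟩ := Nat.exists_eq_add_of_lt h3
    exact h.run.primal_mem (1 + k) (Finset.mem_Icc.2 ⟨by omega, by omega⟩)
  · rw [le_antisymm h3 h1]
    exact h.init_mem

theorem push_back (h : BoundedRun X D Φ Φ' R F G H m T f f' g g' x Q) {t : ℕ}
    (ht : t ∈ Finset.Icc 1 T) {y : E} (hy : y ∈ X) :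
    √(m * t) * f' t (x t) (x (t + 1) - y) + Q t * g' t (x t) (x (t + 1) - y)
      + m * t * bregman Φ Φ' (x (t + 1)) (x t) + m * t * bregman Φ Φ' y (x (t + 1))
      ≤ m * t * bregman Φ Φ' y (x t) := by
  have := h.mirror.add_le_of_isMinOn h.convex (h.run.primal_mem t ht) hy (h.run.primal_min t ht)
  simp only [penalty, stepSize, ← Real.sqrt_eq_rpow, add_apply,
    smul_apply, smul_eq_mul] at this
  simp only [map_sub]
  linarith

theorem Q_nonneg (h : BoundedRun X D Φ Φ' R F G H m T f f' g g' x Q) {t : ℕ} (h1 : 1 ≤ t)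
    (h2 : t ≤ T + 1) : 0 ≤ Q t := by
  rcases Nat.lt_or_ge 1 t with h3 | h3
  · obtain ⟨k, rfl⟩ := Nat.exists_eq_add_of_lt h3
    rw [h.run.dual (1 + k) (Finset.mem_Icc.2 ⟨by omega, by omega⟩)]
    exact le_max_right _ _
  · rw [le_antisymm h3 h1, h.run.init_Q]

theorem norm_step_le_R (h : BoundedRun X D Φ Φ' R F G H m T f f' g g' x Q) {t : ℕ}
    (ht : t ∈ Finset.Icc 1 T) : ‖x (t + 1) - x t‖ ≤ R := by
  rw [Finset.mem_Icc] at ht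
  exact h.mirror.norm_sub_le h.R_nonneg (h.mem (by omega) (by omega)) (h.mem ht.1 (by omega))

theorem abs_constr_grad_le (h : BoundedRun X D Φ Φ' R F G H m T f f' g g' x Q) {t : ℕ}
    (ht : t ∈ Finset.Icc 1 T) (v : E) : |g' t (x t) v| ≤ G * ‖v‖ := by
  rw [Finset.mem_Icc] at ht
  exact ((g' t (x t)).le_opNorm v).trans (mul_le_mul_of_nonneg_right
    (h.constr_grad t _ (h.mem ht.1 (by omega))) (norm_nonneg _))

theorem abs_loss_grad_le (h : BoundedRun X D Φ Φ' R F G H m T f f' g g' x Q) {t : ℕ}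
    (ht : t ∈ Finset.Icc 1 T) (v : E) : |f' t (x t) v| ≤ F * ‖v‖ := by
  have ht' := Finset.mem_Icc.1 ht
  exact ((f' t (x t)).le_opNorm v).trans (mul_le_mul_of_nonneg_right
    (h.loss_grad t ht _ (h.mem ht'.1 (by omega))) (norm_nonneg _))

theorem abs_increment_le (h : BoundedRun X D Φ Φ' R F G H m T f f' g g' x Q) {t : ℕ}
    (ht : t ∈ Finset.Icc 1 T) : |g t (x t) + g' t (x t) (x (t + 1) - x t)| ≤ H + G * R := by
  have ht' := Finset.mem_Icc.1 ht
  refine (abs_add_le _ _).trans (add_le_add (h.constr_bdd t _ (h.mem ht'.1 (by omega))) ?_)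
  exact (h.abs_constr_grad_le ht _).trans
    (mul_le_mul_of_nonneg_left (h.norm_step_le_R ht) h.G_nonneg)

theorem abs_Q_succ_sub_le (h : BoundedRun X D Φ Φ' R F G H m T f f' g g' x Q) {t : ℕ}
    (ht : t ∈ Finset.Icc 1 T) : |Q (t + 1) - Q t| ≤ H + G * R := by
  have ht' := Finset.mem_Icc.1 ht
  have h1 := abs_le.1 (h.abs_increment_le ht)
  have h2 := h.Q_nonneg ht'.1 (by omega)
  have h3 := (abs_nonneg _).trans (h.abs_increment_le ht)
  rw [h.run.dual t ht, abs_le]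
  rcases max_cases (Q t + g t (x t) + g' t (x t) (x (t + 1) - x t)) 0 with ⟨e, _⟩ | ⟨e, _⟩ <;>
    rw [e] <;> constructor <;> linarith

theorem abs_Q_add_sub_le (h : BoundedRun X D Φ Φ' R F G H m T f f' g g' x Q) {a : ℕ}
    (ha : 1 ≤ a) (k : ℕ) (hk : a + k ≤ T + 1) : |Q (a + k) - Q a| ≤ k * (H + G * R) := by
  induction k with
  | zero => simp
  | succ k ih =>
    have h1 := h.abs_Q_succ_sub_le (t := a + k) (Finset.mem_Icc.2 ⟨by omega, by omega⟩)
    have h2 := ih (by omega)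
    have := abs_sub_le (Q (a + k + 1)) (Q (a + k)) (Q a)
    rw [← add_assoc]
    push_cast
    linarith

theorem Q_le (h : BoundedRun X D Φ Φ' R F G H m T f f' g g' x Q) {t : ℕ} (h1 : 1 ≤ t)
    (h2 : t ≤ T + 1) : Q t ≤ t * (H + G * R) := by
  obtain ⟨k, rfl⟩ := Nat.exists_eq_add_of_le h1
  have h3 := (abs_le.1 (h.abs_Q_add_sub_le le_rfl k h2)).2
  rw [h.run.init_Q] at h3
  have h4 : 0 ≤ H + G * R := add_nonneg h.H_nonneg (mul_nonneg h.G_nonneg h.R_nonneg)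
  push_cast
  linarith

theorem m_mul_pos (h : BoundedRun X D Φ Φ' R F G H m T f f' g g' x Q) {t : ℕ} (ht : 1 ≤ t) :
    (0 : ℝ) < m * t := by
  have h1 : (1 : ℝ) ≤ m := by exact_mod_cast h.m_pos
  have h2 : (1 : ℝ) ≤ t := by exact_mod_cast ht
  positivity

/-- Testing the minimizer against the previous iterate puts two divergences on the left, each at
least the squared step, against a linear term of size `(V F + Q G)` times the step; one factor of
the step cancels. -/
theorem norm_step_le (h : BoundedRun X D Φ Φ' R F G H m T f f' g g' x Q) {t : ℕ}
    (ht : t ∈ Finset.Icc 1 T) :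
    ‖x (t + 1) - x t‖ ≤ F / (2 * √(m * t)) + G * Q t / (2 * (m * t)) := by
  have ht' := Finset.mem_Icc.1 ht
  have hx := h.mem ht'.1 (by omega)
  have hx' := h.mem (t := t + 1) (by omega) (by omega)
  have hα := h.m_mul_pos ht'.1
  have hQ := h.Q_nonneg ht'.1 (by omega)
  have h1 := h.push_back ht hx
  rw [bregman_self] at h1
  have h2 := h.mirror.strong _ hx' _ hx
  have h3 := h.mirror.strong _ hx _ hx'
  rw [norm_sub_rev] at h3
  have h4 := (abs_le.1 (h.abs_loss_grad_le ht (x (t + 1) - x t))).1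
  have h5 := (abs_le.1 (h.abs_constr_grad_le ht (x (t + 1) - x t))).1
  set d := ‖x (t + 1) - x t‖ with hd
  set V := √((m : ℝ) * t) with hV
  have hV0 : 0 < V := Real.sqrt_pos.2 hα
  have hVV : V * V = m * t := Real.mul_self_sqrt hα.le
  have h6 : m * t * d ^ 2 + m * t * d ^ 2 ≤ (V * F + Q t * G) * d := by
    have a1 := mul_le_mul_of_nonneg_left h2 hα.le
    have a2 := mul_le_mul_of_nonneg_left h3 hα.le
    have a3 := mul_le_mul_of_nonneg_left h4 hV0.le
    have a4 := mul_le_mul_of_nonneg_left h5 hQ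
    linarith
  have h7 : 2 * (m * t) * d ≤ V * F + Q t * G := by
    rcases (norm_nonneg (x (t + 1) - x t)).eq_or_lt with h0 | h0
    · rw [← hd] at h0
      rw [← h0]
      have := mul_nonneg hV0.le h.F_nonneg
      have := mul_nonneg hQ h.G_nonneg
      linarith
    · rw [← hd] at h0
      refine le_of_mul_le_mul_right ?_ h0
      linarith
  have h8 : F / (2 * V) + G * Q t / (2 * (m * t)) = (V * F + Q t * G) / (2 * (m * t)) := by
    rw [← hVV]
    field_simp
  rw [h8, le_div_iff₀ (by positivity)]
  linarith

/-- The drift-plus-penalty inequality for one step. -/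
theorem drift_plus_penalty (h : BoundedRun X D Φ Φ' R F G H m T f f' g g' x Q) {t : ℕ}
    (ht : t ∈ Finset.Icc 1 T) {y : E} (hy : y ∈ X) :
    √(m * t) * (f t (x t) - f t y) + (Q (t + 1) ^ 2 - Q t ^ 2) / 2
      ≤ Q t * g t y + m * t * (bregman Φ Φ' y (x t) - bregman Φ Φ' y (x (t + 1)))
        + (F ^ 2 / 4 + (H + G * R) ^ 2 / 2) := by
  have ht' := Finset.mem_Icc.1 ht
  have hx := h.mem ht'.1 (by omega)
  have hx' := h.mem (t := t + 1) (by omega) (by omega)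
  have hα := h.m_mul_pos ht'.1
  have hQ := h.Q_nonneg ht'.1 (by omega)
  have h1 := h.push_back ht hy
  have h2 := h.mirror.strong _ hx' _ hx
  have h4 := (abs_le.1 (h.abs_loss_grad_le ht (x (t + 1) - x t))).1
  have h5 := (h.loss t ht).add_le hx hy
  have h6 := (h.constr t).add_le hx hy
  have h7 := h.abs_increment_le ht
  have h8 := h.run.dual t ht
  set d := ‖x (t + 1) - x t‖ with hd
  set V := √((m : ℝ) * t) with hV
  have hV0 : 0 < V := Real.sqrt_pos.2 hα
  have hVV : V * V = m * t := Real.mul_self_sqrt hα.le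
  set p := g t (x t) + g' t (x t) (x (t + 1) - x t) with hp
  -- Truncation at zero cannot increase the square.
  have h9 : Q (t + 1) ^ 2 ≤ (Q t + p) ^ 2 := by
    rw [h8, add_assoc, ← hp]
    rcases max_cases (Q t + p) 0 with ⟨e, _⟩ | ⟨e, _⟩ <;> rw [e]
    simpa using sq_nonneg (Q t + p)
  have h10 : p ^ 2 ≤ (H + G * R) ^ 2 := sq_le_sq' (abs_le.1 h7).1 (abs_le.1 h7).2
  have a1 := mul_le_mul_of_nonneg_left h5 hV0.le
  have a2 := mul_le_mul_of_nonneg_left h6 hQ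
  have a3 := mul_le_mul_of_nonneg_left h4 hV0.le
  have a4 := mul_le_mul_of_nonneg_left h2 hα.le
  rw [← hVV] at a4 h1 ⊢
  -- Here the step size being exactly `V ^ 2` matters: the divergence of the step absorbs the loss
  -- term and leaves a constant independent of `t`.
  have a5 : V * (F * d) ≤ V * V * d ^ 2 + F ^ 2 / 4 := by
    linarith [sq_nonneg (V * d - F / 2)]
  have e1 : f' t (x t) (x (t + 1) - y) = f' t (x t) (x (t + 1) - x t) - f' t (x t) (y - x t) := by
    simp only [map_sub]; ring
  have e2 : g' t (x t) (x (t + 1) - y) = g' t (x t) (x (t + 1) - x t) - g' t (x t) (y - x t) := by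
    simp only [map_sub]; ring
  rw [e1, e2] at h1
  have e3 : Q t * p = Q t * g t (x t) + Q t * g' t (x t) (x (t + 1) - x t) := by rw [hp]; ring
  linarith

/-- The constant of the multi-step drift bound of the virtual queue. -/
def driftConst (R F G H : ℝ) : ℝ :=
  (H + G * R) * H + F * R + (F ^ 2 / 4 + (H + G * R) ^ 2 / 2) + R ^ 2

/-- The condition `m (a + s) ≤ s ^ 2` says that the penalty stays below `s` throughout the window,
so every error term sums to `O(s ^ 2)`. The weight in front of the constraint sum is frozen at `Q
a`, which makes it independent of the randomness in the window beyond time `a`. -/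
theorem window_drift (h : BoundedRun X D Φ Φ' R F G H m T f f' g g' x Q) {a s : ℕ}
    (ha : 1 ≤ a) (hs : 1 ≤ s) (has : a + s ≤ T + 1) (hms : (m : ℝ) * (a + s) ≤ s ^ 2) {y : E}
    (hy : y ∈ X) :
    (Q (a + s) ^ 2 - Q a ^ 2) / 2
      ≤ Q a * ∑ i ∈ Finset.range s, g (a + i) y + s ^ 2 * driftConst R F G H := by
  have hδ : 0 ≤ H + G * R := add_nonneg h.H_nonneg (mul_nonneg h.G_nonneg h.R_nonneg)
  set δ := H + G * R with hδdef
  have hs1 : (1 : ℝ) ≤ s := by exact_mod_cast hs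
  have hm0 : (0 : ℝ) ≤ m := Nat.cast_nonneg m
  set B := F ^ 2 / 4 + δ ^ 2 / 2 with hB
  have hB0 : 0 ≤ B := by positivity
  -- The nonnegative potential `R ^ 2 - D` lets the divergence terms be summed by parts although
  -- their coefficients grow. Each step costs `s δ H` for replacing `Q (a + k)` by `Q a`, `s F R`
  -- for the loss, and `B`.
  have key : ∀ k ≤ s, (Q (a + k) ^ 2 - Q a ^ 2) / 2
      ≤ Q a * ∑ i ∈ Finset.range k, g (a + i) y + k * (s * δ * H + s * (F * R) + B)
        + m * (a + k) * (R ^ 2 - bregman Φ Φ' y (x (a + k))) := by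
    intro k
    induction k with
    | zero =>
      intro _
      have h1 := h.mirror.bounded y hy (x a) (h.mem ha (by omega))
      have := mul_nonneg (mul_nonneg hm0 (Nat.cast_nonneg (α := ℝ) a)) (sub_nonneg.2 h1)
      simpa using this
    | succ k ih =>
      intro hk
      have hk' : (k : ℝ) ≤ s := by exact_mod_cast (by omega : k ≤ s)
      have ih := ih (by omega)
      have ht : a + k ∈ Finset.Icc 1 T := Finset.mem_Icc.2 ⟨by omega, by omega⟩
      have hx := h.mem (t := a + k) (by omega) (by omega)
      have hx' := h.mem (t := a + k + 1) (by omega) (by omega)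
      have h1 := h.drift_plus_penalty ht hy
      have h2 := (h.loss _ ht).sub_le (h.loss_grad _ ht) hy hx
      have h2' : F * ‖y - x (a + k)‖ ≤ F * R := mul_le_mul_of_nonneg_left
        (h.mirror.norm_sub_le h.R_nonneg hy hx) h.F_nonneg
      have hV : √((m : ℝ) * (a + k : ℕ)) ≤ s := by
        rw [Real.sqrt_le_left (by linarith)]
        refine le_trans (mul_le_mul_of_nonneg_left ?_ hm0) hms
        push_cast
        linarith
      have h3 : √((m : ℝ) * (a + k : ℕ)) * (f (a + k) y - f (a + k) (x (a + k)))
          ≤ s * (F * R) :=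
        (mul_le_mul_of_nonneg_left (h2.trans h2') (Real.sqrt_nonneg _)).trans
          (mul_le_mul_of_nonneg_right hV (mul_nonneg h.F_nonneg h.R_nonneg))
      have h4 : (Q (a + k) - Q a) * g (a + k) y ≤ s * δ * H := by
        refine (le_abs_self _).trans ?_
        rw [abs_mul]
        refine mul_le_mul ?_ (h.constr_bdd _ y hy) (abs_nonneg _) (by positivity)
        exact (h.abs_Q_add_sub_le ha k (by omega)).trans (mul_le_mul_of_nonneg_right hk' hδ)
      have h5 := mul_nonneg hm0 (sub_nonneg.2 (h.mirror.bounded y hy _ hx'))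
      rw [Finset.sum_range_succ, ← add_assoc]
      rw [← hδdef, ← hB] at h1
      push_cast at *
      linarith
  have h1 := key s le_rfl
  have h2 : m * (a + s) * (R ^ 2 - bregman Φ Φ' y (x (a + s))) ≤ s ^ 2 * R ^ 2 := by
    have hx := h.mem (t := a + s) (by omega) has
    refine mul_le_mul hms ?_ (sub_nonneg.2 (h.mirror.bounded y hy _ hx)) (by positivity)
    linarith [h.mirror.bregman_nonneg hy hx]
  have h3 : s * B ≤ s ^ 2 * B := by
    refine mul_le_mul_of_nonneg_right ?_ hB0
    nlinarith
  rw [driftConst, ← hδdef, ← hB]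
  linarith

/-- A large `Q a` absorbs the quadratic error into `Q a * (ε / 8 * s)`. Since `(Q (a + s) ^ 2 - Q a
^ 2) / 2` is at least `Q a * (Q (a + s) - Q a)`, one may then divide by `Q a`. -/
theorem Q_add_le_of_large (h : BoundedRun X D Φ Φ' R F G H m T f f' g g' x Q) {a s : ℕ}
    (ha : 1 ≤ a) (hs : 1 ≤ s) (has : a + s ≤ T + 1) (hms : (m : ℝ) * (a + s) ≤ s ^ 2) {y : E}
    (hy : y ∈ X) {ε : ℝ} (hε : 0 < ε) (hQ : 8 * driftConst R F G H / ε * s ≤ Q a)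
    (hQ0 : 0 < Q a) :
    Q (a + s) ≤ Q a + (∑ i ∈ Finset.range s, g (a + i) y + ε / 8 * s) := by
  have h1 := h.window_drift ha hs has hms hy
  have h2 : s ^ 2 * driftConst R F G H ≤ Q a * (ε / 8 * s) := by
    have := mul_le_mul_of_nonneg_right hQ (show 0 ≤ ε / 8 * s by positivity)
    refine le_trans (le_of_eq ?_) this
    field_simp
  refine le_of_mul_le_mul_left ?_ hQ0
  nlinarith [sq_nonneg (Q (a + s) - Q a)]

/-- Dividing one step by the penalty leaves `V (D - D')`, summed by parts with `V` increasing and `D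
≤ R ^ 2`, and a queue term with decreasing weight `1 / V`, whose telescoping remainder has a
favourable sign. -/
theorem regret_le (h : BoundedRun X D Φ Φ' R F G H m T f f' g g' x Q) {y : E} (hy : y ∈ X) :
    ∑ t ∈ Finset.Icc 1 T, (f t (x t) - f t y)
      ≤ ∑ t ∈ Finset.Icc 1 T,
          (Q t * g t y + (F ^ 2 / 4 + (H + G * R) ^ 2 / 2)) / √(m * t)
        + √(m * (T + 1)) * R ^ 2 := by
  have hm0 : (0 : ℝ) ≤ m := Nat.cast_nonneg m
  set B := F ^ 2 / 4 + (H + G * R) ^ 2 / 2 with hB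
  have key : ∀ n ≤ T, ∑ t ∈ Finset.Icc 1 n, (f t (x t) - f t y)
      ≤ ∑ t ∈ Finset.Icc 1 n, (Q t * g t y + B) / √(m * t)
        + √(m * (n + 1 : ℕ)) * (R ^ 2 - bregman Φ Φ' y (x (n + 1)))
        - Q (n + 1) ^ 2 / 2 / √(m * (n + 1 : ℕ)) := by
    intro n
    induction n with
    | zero =>
      intro _
      have h1 := h.mirror.bounded y hy _ h.init_mem
      have := mul_nonneg (Real.sqrt_nonneg (m : ℝ)) (sub_nonneg.2 h1)
      simpa [h.run.init_Q] using this
    | succ n ih =>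
      intro hn
      have ih := ih (by omega)
      have ht : n + 1 ∈ Finset.Icc 1 T := Finset.mem_Icc.2 ⟨by omega, hn⟩
      have h1 := h.drift_plus_penalty ht hy
      have hα := h.m_mul_pos (t := n + 1) (by omega)
      have hα' := h.m_mul_pos (t := n + 1 + 1) (by omega)
      set V := √((m : ℝ) * (n + 1 : ℕ)) with hV
      set V' := √((m : ℝ) * (n + 1 + 1 : ℕ)) with hV'
      have hV0 : 0 < V := Real.sqrt_pos.2 hα
      have hVV' : V ≤ V' := Real.sqrt_le_sqrt (mul_le_mul_of_nonneg_left
        (by push_cast; linarith) hm0)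
      have hVV : V * V = m * (n + 1 : ℕ) := Real.mul_self_sqrt hα.le
      have hD := sub_nonneg.2
        (h.mirror.bounded y hy _ (h.mem (t := n + 1 + 1) (by omega) (by omega)))
      have h2 := mul_le_mul_of_nonneg_right hVV' hD
      have h3 : Q (n + 1 + 1) ^ 2 / 2 / V' ≤ Q (n + 1 + 1) ^ 2 / 2 / V := by gcongr
      have h4 : f (n + 1) (x (n + 1)) - f (n + 1) y
          ≤ (Q (n + 1) * g (n + 1) y + B) / V
            + V * (bregman Φ Φ' y (x (n + 1)) - bregman Φ Φ' y (x (n + 1 + 1)))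
            + Q (n + 1) ^ 2 / 2 / V - Q (n + 1 + 1) ^ 2 / 2 / V := by
        rw [← hVV, ← hB] at h1
        refine le_of_mul_le_mul_left ?_ hV0
        have e : V * ((Q (n + 1) * g (n + 1) y + B) / V
            + V * (bregman Φ Φ' y (x (n + 1)) - bregman Φ Φ' y (x (n + 1 + 1)))
            + Q (n + 1) ^ 2 / 2 / V - Q (n + 1 + 1) ^ 2 / 2 / V)
            = (Q (n + 1) * g (n + 1) y + B)
            + V * V * (bregman Φ Φ' y (x (n + 1)) - bregman Φ Φ' y (x (n + 1 + 1)))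
            + Q (n + 1) ^ 2 / 2 - Q (n + 1 + 1) ^ 2 / 2 := by
          field_simp
        rw [e]
        linarith
      rw [Finset.sum_Icc_succ_top (by omega), Finset.sum_Icc_succ_top (by omega)]
      linarith
  have h1 := key T le_rfl
  have h2 := mul_nonneg (Real.sqrt_nonneg ((m : ℝ) * (T + 1 : ℕ)))
    (h.mirror.bregman_nonneg hy (h.mem (t := T + 1) (by omega) le_rfl))
  have h3 : 0 ≤ Q (T + 1) ^ 2 / 2 / √((m : ℝ) * (T + 1 : ℕ)) := by positivity
  push_cast at *
  linarith

/-- Each queue update dominates its untruncated increment, which differs from the observed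
constraint value by at most `G` times the step. -/
theorem violation_le (h : BoundedRun X D Φ Φ' R F G H m T f f' g g' x Q) :
    ∑ t ∈ Finset.Icc 1 T, g t (x t)
      ≤ Q (T + 1) + G * ∑ t ∈ Finset.Icc 1 T, ‖x (t + 1) - x t‖ := by
  have key : ∀ n ≤ T, ∑ t ∈ Finset.Icc 1 n, g t (x t)
      ≤ Q (n + 1) + G * ∑ t ∈ Finset.Icc 1 n, ‖x (t + 1) - x t‖ := by
    intro n
    induction n with
    | zero => intro _; simp [h.run.init_Q]
    | succ n ih =>
      intro hn
      have ih := ih (by omega)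
      have ht : n + 1 ∈ Finset.Icc 1 T := Finset.mem_Icc.2 ⟨by omega, hn⟩
      have h1 := h.run.dual _ ht
      have h2 := le_max_left (Q (n + 1) + g (n + 1) (x (n + 1))
        + g' (n + 1) (x (n + 1)) (x (n + 1 + 1) - x (n + 1))) 0
      have h3 := (abs_le.1 (h.abs_constr_grad_le ht (x (n + 1 + 1) - x (n + 1)))).1
      rw [Finset.sum_Icc_succ_top (by omega), Finset.sum_Icc_succ_top (by omega), mul_add]
      linarith
  exact key T le_rfl

/-- Two runs on data that agree up to time `t` agree up to time `t + 1`. -/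
theorem eq_of_eq (h : BoundedRun X D Φ Φ' R F G H m T f f' g g' x Q)
    {f₂ : ℕ → E → ℝ} {f₂' : ℕ → E → E →L[ℝ] ℝ} {g₂ : ℕ → E → ℝ} {g₂' : ℕ → E → E →L[ℝ] ℝ}
    {x₂ : ℕ → E} {Q₂ : ℕ → ℝ} (h₂ : BoundedRun X D Φ Φ' R F G H m T f₂ f₂' g₂ g₂' x₂ Q₂)
    (h1 : x 1 = x₂ 1) {t : ℕ} (ht : t ≤ T)
    (heq : ∀ i ∈ Finset.Icc 1 t, f' i = f₂' i ∧ g i = g₂ i ∧ g' i = g₂' i) :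
    x (t + 1) = x₂ (t + 1) ∧ Q (t + 1) = Q₂ (t + 1) := by
  induction t with
  | zero => exact ⟨h1, h.run.init_Q.trans h₂.run.init_Q.symm⟩
  | succ t ih =>
    obtain ⟨ihx, ihQ⟩ := ih (by omega) fun i hi =>
      heq i (Finset.Icc_subset_Icc_right (Nat.le_succ t) hi)
    obtain ⟨e1, e2, e3⟩ := heq (t + 1) (Finset.mem_Icc.2 ⟨by omega, le_rfl⟩)
    have hmem : t + 1 ∈ Finset.Icc 1 T := Finset.mem_Icc.2 ⟨by omega, ht⟩
    have hx := h.run.primal_mem _ hmem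
    have hx₂ := h₂.run.primal_mem _ hmem
    -- The minimizer is unique: testing each of the two against the other and adding leaves a
    -- positive multiple of their symmetrized divergence bounded by zero.
    have a1 := h.push_back hmem hx₂
    have a2 := h₂.push_back hmem hx
    rw [← e1, ← e3, ← ihx, ← ihQ] at a2
    have b1 := h.mirror.strong _ hx₂ _ hx
    have b2 := h.mirror.strong _ hx _ hx₂
    have hα := h.m_mul_pos (t := t + 1) (by omega)
    have c1 := mul_le_mul_of_nonneg_left b1 hα.le
    have c2 := mul_le_mul_of_nonneg_left b2 hα.le
    rw [norm_sub_rev] at c1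
    have hxx : x (t + 1 + 1) = x₂ (t + 1 + 1) := by
      have d1 : (m : ℝ) * (t + 1 : ℕ) * ‖x (t + 1 + 1) - x₂ (t + 1 + 1)‖ ^ 2 ≤ 0 := by
        simp only [map_sub] at a1 a2
        linarith
      have d2 : ‖x (t + 1 + 1) - x₂ (t + 1 + 1)‖ ^ 2 ≤ 0 := by
        by_contra hcon
        linarith [mul_pos hα (not_le.1 hcon)]
      have d3 : ‖x (t + 1 + 1) - x₂ (t + 1 + 1)‖ = 0 :=
        pow_eq_zero_iff two_ne_zero |>.1 (le_antisymm d2 (sq_nonneg _))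
      exact sub_eq_zero.1 (norm_eq_zero.1 d3)
    refine ⟨hxx, ?_⟩
    rw [h.run.dual _ hmem, h₂.run.dual _ hmem, ← e2, ← e3, ← ihx, ← ihQ, hxx]

end BoundedRun

end Deterministic

theorem sum_inv_sqrt_le (n : ℕ) : ∑ t ∈ Finset.Icc 1 n, 1 / √(t : ℝ) ≤ 2 * √(n : ℝ) := by
  induction n with
  | zero => simp
  | succ n ih =>
    rw [Finset.sum_Icc_succ_top (by omega)]
    have h0 : (0 : ℝ) ≤ n := Nat.cast_nonneg n
    have h1 : 0 < √((n + 1 : ℕ) : ℝ) := Real.sqrt_pos.2 (by positivity)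
    have h2 : 1 / √((n + 1 : ℕ) : ℝ) ≤ 2 * √((n + 1 : ℕ) : ℝ) - 2 * √(n : ℝ) := by
      rw [div_le_iff₀ h1]
      have e1 : √((n + 1 : ℕ) : ℝ) * √((n + 1 : ℕ) : ℝ) = n + 1 := by
        rw [Real.mul_self_sqrt (by positivity)]; push_cast; ring
      have e2 : √(n : ℝ) * √(n : ℝ) = n := Real.mul_self_sqrt h0
      nlinarith [sq_nonneg (√((n + 1 : ℕ) : ℝ) - √(n : ℝ))]
    linarith

/-! ### The algorithm driven by an ergodic chain -/

section Stochastic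

variable {E : Type u} [NormedAddCommGroup E] [NormedSpace ℝ E]
  {S : Type v} [Fintype S] [DecidableEq S] [MeasurableSpace S] [MeasurableSingletonClass S]
  {Ω : Type w} [MeasurableSpace Ω]

/-- Runs of the algorithm with `β = 1/2` on constraints driven by an ergodic chain `ξ`. The loss
function at time `t` may depend on `ξ t`. -/
structure ErgodicRun (P : Measure Ω) (X D : Set E) (Φ : E → ℝ) (Φ' : E → E →L[ℝ] ℝ)
    (R F G H ε : ℝ) (K : Matrix S S ℝ) (π : S → ℝ) (ξ : ℕ → Ω → S) (m τ T : ℕ)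
    (f : Ω → ℕ → E → ℝ) (f' : Ω → ℕ → E → E →L[ℝ] ℝ) (g : E → S → ℝ) (g' : E → S → E →L[ℝ] ℝ)
    (x : ℕ → Ω → E) (Q : ℕ → Ω → ℝ) : Prop where
  F_pos : 0 < F
  H_pos : 0 < H
  slack_pos : 0 < ε
  bounded : ∀ ω, BoundedRun X D Φ Φ' R F G H m T (f ω) (f' ω) (fun t y => g y (ξ t ω))
    (fun t y => g' y (ξ t ω)) (fun t => x t ω) (fun t => Q t ω)
  constr : ∀ s, IsDiffConvexOn X (fun y => g y s) (fun y => g' y s)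
  constr_grad : ∀ y ∈ X, ∀ s, ‖g' y s‖ ≤ G
  constr_bdd : ∀ y ∈ X, ∀ s, |g y s| ≤ H
  slater : ∃ z ∈ X, mean π (g z) ≤ -ε
  init_eq : ∀ ω ω', x 1 ω = x 1 ω'
  loss_eq : ∀ t ∈ Finset.Icc 1 T, ∀ ω ω', ξ t ω = ξ t ω' → f ω t = f ω' t ∧ f' ω t = f' ω' t
  ergodic : IsErgodic K
  stationary : IsStationary K π
  chain : IsMarkovChain P K ξ
  four_le : 4 ≤ T
  m_eq : m = tauMix K π (1 / 4)
  tau_eq : τ = tauMix K π (1 / (T : ℝ))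

/-- The rate in the exponential moment bound of the virtual queue. -/
def expRate (H ε : ℝ) : ℝ := ε / (16 * (H + ε) ^ 2)

/-- The bound on the exponential moments of the virtual queue. -/
def expMoment (R F G H ε : ℝ) : ℝ :=
  Real.exp (expRate H ε * (8 * BoundedRun.driftConst R F G H / ε + (H + G * R)))
    / (expRate H ε * ε / 16)

/-- The constant in the bound on the expected virtual queue. -/
def queueConst (R F G H ε : ℝ) : ℝ :=
  3 * ⌈(4 * H + 2 * ε) / ε⌉₊ * (expMoment R F G H ε / expRate H ε) + (H + G * R)
    + 8 * H / ε * (H + G * R)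

namespace ErgodicRun

variable {P : Measure Ω} [IsProbabilityMeasure P] {X D : Set E} {Φ : E → ℝ} {Φ' : E → E →L[ℝ] ℝ}
  {R F G H ε : ℝ} {K : Matrix S S ℝ} {π : S → ℝ} {ξ : ℕ → Ω → S} {m τ T : ℕ}
  {f : Ω → ℕ → E → ℝ} {f' : Ω → ℕ → E → E →L[ℝ] ℝ} {g : E → S → ℝ} {g' : E → S → E →L[ℝ] ℝ}
  {x : ℕ → Ω → E} {Q : ℕ → Ω → ℝ}

theorem T_pos (h : ErgodicRun P X D Φ Φ' R F G H ε K π ξ m τ T f f' g g' x Q) : (0 : ℝ) < T := by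
  have : (4 : ℝ) ≤ T := by exact_mod_cast h.four_le
  linarith

theorem one_le_m (h : ErgodicRun P X D Φ Φ' R F G H ε K π ξ m τ T f f' g g' x Q) : 1 ≤ m :=
  h.m_eq ▸ (tauMix_spec h.ergodic h.stationary (by norm_num)).1

theorem m_le_tau (h : ErgodicRun P X D Φ Φ' R F G H ε K π ξ m τ T f f' g g' x Q) : m ≤ τ := by
  rw [h.m_eq, h.tau_eq]
  refine tauMix_anti h.ergodic h.stationary (one_div_pos.2 h.T_pos) ?_
  exact one_div_le_one_div_of_le (by norm_num) (by exact_mod_cast h.four_le)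

theorem one_le_m_real (h : ErgodicRun P X D Φ Φ' R F G H ε K π ξ m τ T f f' g g' x Q) :
    (1 : ℝ) ≤ m := by exact_mod_cast h.one_le_m

theorem m_le_tau_real (h : ErgodicRun P X D Φ Φ' R F G H ε K π ξ m τ T f f' g g' x Q) :
    (m : ℝ) ≤ τ := by exact_mod_cast h.m_le_tau

theorem nonempty (_ : ErgodicRun P X D Φ Φ' R F G H ε K π ξ m τ T f f' g g' x Q) : Nonempty Ω :=
  P.nonempty_of_neZero

theorem R_nonneg (h : ErgodicRun P X D Φ Φ' R F G H ε K π ξ m τ T f f' g g' x Q) : 0 ≤ R :=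
  let ⟨ω⟩ := h.nonempty
  (h.bounded ω).R_nonneg

theorem G_nonneg (h : ErgodicRun P X D Φ Φ' R F G H ε K π ξ m τ T f f' g g' x Q) : 0 ≤ G :=
  let ⟨ω⟩ := h.nonempty
  (h.bounded ω).G_nonneg

theorem delta_nonneg (h : ErgodicRun P X D Φ Φ' R F G H ε K π ξ m τ T f f' g g' x Q) :
    0 ≤ H + G * R :=
  add_nonneg h.H_pos.le (mul_nonneg h.G_nonneg h.R_nonneg)

/-- No measurability of the iterates is assumed; uniqueness of the minimizer makes them functions of
the observed states. In fact the states strictly before `t` suffice. -/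
theorem xQ_dep (h : ErgodicRun P X D Φ Φ' R F G H ε K π ξ m τ T f f' g g' x Q) {t : ℕ}
    (h1 : 1 ≤ t) (h2 : t ≤ T + 1) : PathDep ξ t fun ω => (x t ω, Q t ω) := by
  obtain ⟨k, rfl⟩ := Nat.exists_eq_add_of_le' h1
  intro ω ω' hω
  have := (h.bounded ω).eq_of_eq (h.bounded ω') (h.init_eq ω ω') (t := k) (by omega)
    fun i hi => by
      have e := hω i (Finset.Icc_subset_Icc_right (Nat.le_succ k) hi)
      exact ⟨(h.loss_eq i (Finset.Icc_subset_Icc_right (by omega) hi) ω ω' e).2,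
        by simp only [e], by simp only [e]⟩
  exact Prod.ext this.1 this.2

theorem x_dep (h : ErgodicRun P X D Φ Φ' R F G H ε K π ξ m τ T f f' g g' x Q) {t : ℕ}
    (h1 : 1 ≤ t) (h2 : t ≤ T + 1) : PathDep ξ t (x t) :=
  (h.xQ_dep h1 h2).comp Prod.fst

theorem Q_dep (h : ErgodicRun P X D Φ Φ' R F G H ε K π ξ m τ T f f' g g' x Q) {t : ℕ}
    (h1 : 1 ≤ t) (h2 : t ≤ T + 1) : PathDep ξ t (Q t) :=
  (h.xQ_dep h1 h2).comp Prod.snd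

theorem integrable_Q (h : ErgodicRun P X D Φ Φ' R F G H ε K π ξ m τ T f f' g g' x Q) {t : ℕ}
    (h1 : 1 ≤ t) (h2 : t ≤ T + 1) : Integrable (Q t) P :=
  h.chain.integrable (h.Q_dep h1 h2)

/-! ### Exponential moments and expectation of the virtual queue. -/

theorem expRate_pos (h : ErgodicRun P X D Φ Φ' R F G H ε K π ξ m τ T f f' g g' x Q) :
    0 < expRate H ε := by
  have := h.H_pos
  have := h.slack_pos
  unfold expRate
  positivity

theorem expRate_mul_le (h : ErgodicRun P X D Φ Φ' R F G H ε K π ξ m τ T f f' g g' x Q) :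
    expRate H ε * (H + ε) ≤ 1 := by
  have := h.H_pos
  have := h.slack_pos
  have e : expRate H ε * (H + ε) = ε / (16 * (H + ε)) := by
    unfold expRate
    field_simp
  rw [e, div_le_one (by positivity)]
  linarith

/-- The rate is tuned so that the second-order error of the exponential is a quarter of the drift `κ
ε / 4` supplied by Slater's point. -/
theorem expRate_sq (h : ErgodicRun P X D Φ Φ' R F G H ε K π ξ m τ T f f' g g' x Q) :
    (expRate H ε * (H + ε)) ^ 2 = expRate H ε * ε / 16 := by
  have := h.H_pos
  have := h.slack_pos
  unfold expRate
  field_simp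

theorem driftConst_nonneg (h : ErgodicRun P X D Φ Φ' R F G H ε K π ξ m τ T f f' g g' x Q) :
    0 ≤ BoundedRun.driftConst R F G H := by
  have := h.H_pos
  have := h.F_pos
  have := h.R_nonneg
  have := h.G_nonneg
  unfold BoundedRun.driftConst
  positivity

/-- A weight determined at time `a` is nearly independent of the constraint values at a point over
a long window that starts at time `a`. -/
theorem integral_mul_window_le
    (h : ErgodicRun P X D Φ Φ' R F G H ε K π ξ m τ T f f' g g' x Q) (hT : 4 * H ≤ ε * T)
    {z : E} (hz : z ∈ X) (hzε : mean π (g z) ≤ -ε) {a s : ℕ} (ha : 1 ≤ a)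
    (hs : (4 * H + 2 * ε) * τ ≤ ε * s) {W : Ω → ℝ} (hW : PathDep ξ a W) (hW0 : ∀ ω, 0 ≤ W ω) :
    ∫ ω, W ω * ∑ i ∈ Finset.range s, g z (ξ (a + i) ω) ∂P ≤ -(ε / 4 * s) * ∫ ω, W ω ∂P := by
  have hH := h.H_pos
  have hε := h.slack_pos
  have hWi : 0 ≤ ∫ ω, W ω ∂P := integral_nonneg hW0
  have hint : ∀ i, Integrable (fun ω => W ω * g z (ξ (a + i) ω)) P := fun i =>
    h.chain.integrable (t := a + i) ((hW.mono (Nat.le_add_right a i)).comp₂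
      (pathDep_self (by omega)) fun u s => u * g z s)
  -- During the first `τ` steps only the bound `H` is available; afterwards mixing gives `-ε + 2 H /
  -- T ≤ -ε / 2`. The window is long enough that the initial loss `τ (H + ε / 2)` is at most half of
  -- the gain `ε s / 2`.
  have h1 : ∀ i, ∫ ω, W ω * g z (ξ (a + i) ω) ∂P
      ≤ (-(ε / 2) + if i < τ then H + ε / 2 else 0) * ∫ ω, W ω ∂P := by
    intro i
    split_ifs with hi
    · rw [← integral_const_mul]
      refine integral_mono (hint i) ((h.chain.integrable hW).const_mul _) fun ω => ?_
      show W ω * _ ≤ _ * W ω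
      rw [mul_comm]
      refine mul_le_mul_of_nonneg_right ?_ (hW0 ω)
      linarith [(abs_le.1 (h.constr_bdd z hz (ξ (a + i) ω))).2]
    · have hi' : tauMix K π (1 / (T : ℝ)) ≤ i := h.tau_eq ▸ not_lt.1 hi
      refine (h.chain.integral_mul_le h.ergodic h.stationary ha (one_div_pos.2 h.T_pos) hi' hW hW0
        (h.constr_bdd z hz)).trans (mul_le_mul_of_nonneg_right ?_ hWi)
      have : 2 * H * (1 / (T : ℝ)) ≤ ε / 2 := by
        rw [mul_one_div, div_le_iff₀ h.T_pos]
        linarith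
      linarith
  have h2 : ∑ i ∈ Finset.range s, (if i < τ then H + ε / 2 else 0) ≤ τ * (H + ε / 2) := by
    rw [← Finset.sum_filter, Finset.sum_const, nsmul_eq_mul]
    refine mul_le_mul_of_nonneg_right ?_ (by positivity)
    have : (Finset.range s).filter (· < τ) ⊆ Finset.range τ := fun i hi =>
      Finset.mem_range.2 (Finset.mem_filter.1 hi).2
    exact_mod_cast (Finset.card_le_card this).trans (Finset.card_range τ).le
  simp only [Finset.mul_sum]
  rw [integral_finsetSum _ fun i _ => hint i]
  refine (Finset.sum_le_sum fun i _ => h1 i).trans ?_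
  rw [← Finset.sum_mul, Finset.sum_add_distrib, Finset.sum_const, Finset.card_range, nsmul_eq_mul]
  refine mul_le_mul_of_nonneg_right ?_ hWi
  linarith

/-- Strong induction backwards by windows of one fixed length `s`, adequate for all times up to `N`.
With `γ = κ ε / 16`, a window contracts the moment by `1 - γ` where the queue is large and adds at
most `exp (κ (l + δ)) = γ M` where it is small, so the bound `M` reproduces itself. -/
theorem integral_exp_le (h : ErgodicRun P X D Φ Φ' R F G H ε K π ξ m τ T f f' g g' x Q)
    (hT : 4 * H ≤ ε * T) {s N : ℕ} (hs1 : 1 ≤ s) (hs : (4 * H + 2 * ε) * τ ≤ ε * s)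
    (hN : N ≤ T + 1) (hms : (m : ℝ) * N ≤ s ^ 2) {n : ℕ} (hn1 : 1 ≤ n) (hn : n ≤ N) :
    ∫ ω, Real.exp (expRate H ε / s * Q n ω) ∂P ≤ expMoment R F G H ε := by
  obtain ⟨z, hz, hzε⟩ := h.slater
  have hH := h.H_pos
  have hε := h.slack_pos
  have hδ := h.delta_nonneg
  have hC := h.driftConst_nonneg
  have hκ := h.expRate_pos
  have hκ1 := h.expRate_mul_le
  have hκ2 := h.expRate_sq
  have hs0 : (0 : ℝ) < s := by exact_mod_cast hs1
  set δ := H + G * R with hδdef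
  set κ := expRate H ε with hκdef
  set l := 8 * BoundedRun.driftConst R F G H / ε with hldef
  have hl : 0 ≤ l := by positivity
  set r := κ / s with hr
  have hr0 : 0 < r := by positivity
  have hrs : r * s = κ := by rw [hr]; field_simp
  have hγ0 : 0 < κ * ε / 16 := by positivity
  have hγ1 : κ * ε / 16 ≤ 1 := by
    rw [← hκ2]
    exact pow_le_one₀ (by positivity) hκ1
  have hM : Real.exp (κ * (l + δ)) = κ * ε / 16 * expMoment R F G H ε := by
    rw [expMoment, ← hκdef, ← hldef, ← hδdef]
    field_simp
  have hM0 : 0 < expMoment R F G H ε := by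
    have := hM ▸ Real.exp_pos (κ * (l + δ))
    exact pos_of_mul_pos_right this hγ0.le
  set M := expMoment R F G H ε with hMdef
  have hdep : ∀ t, 1 ≤ t → t ≤ T + 1 → PathDep ξ t fun ω => Real.exp (r * Q t ω) :=
    fun t h1 h2 => (h.Q_dep h1 h2).comp fun q => Real.exp (r * q)
  induction n using Nat.strong_induction_on with
  | _ n ih =>
    have hnT : n ≤ T + 1 := hn.trans hN
    rcases le_or_gt n s with hns | hns
    · have h1 : ∀ ω, Real.exp (r * Q n ω) ≤ M := fun ω => by
        have h2 := (h.bounded ω).Q_le hn1 hnT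
        have h3 : (n : ℝ) * δ ≤ s * δ := mul_le_mul_of_nonneg_right (by exact_mod_cast hns) hδ
        have h4 : r * Q n ω ≤ κ * (l + δ) := by
          have := mul_le_mul_of_nonneg_left (h2.trans h3) hr0.le
          have h5 : 0 ≤ κ * l := by positivity
          rw [← mul_assoc, hrs] at this
          linarith
        refine (Real.exp_le_exp.2 h4).trans ?_
        rw [hM]
        nlinarith
      have := integral_mono (h.chain.integrable (hdep n hn1 hnT)) (integrable_const M) h1
      rwa [integral_const, probReal_univ, one_smul] at this
    · obtain ⟨a, rfl⟩ := Nat.exists_eq_add_of_le' hns.le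
      have ha : 1 ≤ a := by omega
      have haT : a ≤ T + 1 := by omega
      have ihM := ih a (by omega) ha (by omega)
      -- Restricting to large `Q a` yields a nonnegative weight still determined at time `a`, as the
      -- window estimate requires.
      set W : Ω → ℝ := fun ω => if l * s < Q a ω then Real.exp (r * Q a ω) else 0 with hW
      have hWdep : PathDep ξ a W :=
        (h.Q_dep ha haT).comp fun q => if l * s < q then Real.exp (r * q) else 0
      have hW0 : ∀ ω, 0 ≤ W ω := fun ω => by
        simp only [hW]
        split_ifs
        exacts [(Real.exp_pos _).le, le_rfl]
      have hWle : ∀ ω, W ω ≤ Real.exp (r * Q a ω) := fun ω => by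
        simp only [hW]
        split_ifs
        exacts [le_rfl, (Real.exp_pos _).le]
      have hWi := h.chain.integrable hWdep
      set Y : Ω → ℝ := fun ω => ∑ i ∈ Finset.range s, g z (ξ (a + i) ω) with hY
      have hYdep : PathDep ξ (a + s) Y := PathDep.sum fun i hi =>
        ((pathDep_self (ξ := ξ) (t := a + i) (by omega)).comp fun s => g z s).mono
          (by have := Finset.mem_range.1 hi; omega)
      have hYb : ∀ ω, |Y ω| ≤ s * H := fun ω => by
        refine (Finset.abs_sum_le_sum_abs _ _).trans ?_
        refine (Finset.sum_le_sum fun i _ => h.constr_bdd z hz (ξ (a + i) ω)).trans ?_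
        rw [Finset.sum_const, Finset.card_range, nsmul_eq_mul]
      have hWY := h.integral_mul_window_le hT hz hzε ha hs hWdep hW0
      -- On the large part `exp u ≤ 1 + u + u ^ 2` is used for `|u| ≤ 1`: the term `κ ε / 8` is the
      -- deterministic part of `u`, and `κ ε / 16` bounds `u ^ 2`.
      have hpt : ∀ ω, Real.exp (r * Q (a + s) ω)
          ≤ W ω * (1 + κ * ε / 8 + κ * ε / 16) + r * (W ω * Y ω) + κ * ε / 16 * M := by
        intro ω
        have hcast : ((a + s : ℕ) : ℝ) = a + s := by push_cast; ring
        have hms' : (m : ℝ) * (a + s) ≤ s ^ 2 := by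
          refine le_trans (mul_le_mul_of_nonneg_left ?_ (Nat.cast_nonneg m)) hms
          rw [← hcast]
          exact_mod_cast hn
        simp only [hW]
        split_ifs with hlarge
        · have hQ0 : 0 < Q a ω := lt_of_le_of_lt (by positivity) hlarge
          have h1 := (h.bounded ω).Q_add_le_of_large ha hs1 hnT hms' hz hε hlarge.le hQ0
          set u := r * (Y ω + ε / 8 * s) with hu
          have hu1 : |u| ≤ κ * (H + ε) := by
            rw [hu, abs_mul, abs_of_pos hr0, ← hrs, mul_assoc]
            refine mul_le_mul_of_nonneg_left ?_ hr0.le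
            refine (abs_add_le _ _).trans ?_
            rw [abs_of_nonneg (show 0 ≤ ε / 8 * s by positivity)]
            nlinarith [hYb ω]
          have hu2 := (abs_le.1 (Real.abs_exp_sub_one_sub_id_le (hu1.trans hκ1))).2
          have hu3 : u ^ 2 ≤ κ * ε / 16 := by
            rw [← hκ2]
            exact sq_le_sq' (abs_le.1 hu1).1 (abs_le.1 hu1).2
          have hu4 : Real.exp (r * Q (a + s) ω) ≤ Real.exp (r * Q a ω) * Real.exp u := by
            rw [← Real.exp_add]
            refine Real.exp_le_exp.2 ?_
            have := mul_le_mul_of_nonneg_left h1 hr0.le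
            rw [hu]
            linarith
          have hu5 : Real.exp u ≤ 1 + κ * ε / 8 + κ * ε / 16 + r * Y ω := by
            have : u = r * Y ω + κ * ε / 8 := by rw [hu, ← hrs]; ring
            linarith
          have hu6 := mul_le_mul_of_nonneg_left hu5 (Real.exp_pos (r * Q a ω)).le
          have : 0 ≤ κ * ε / 16 * M := by positivity
          linarith
        · have h1 := (abs_le.1 ((h.bounded ω).abs_Q_add_sub_le ha s hnT)).2
          rw [← hM]
          have h2 : r * Q (a + s) ω ≤ κ * (l + δ) := by
            have h3 : Q (a + s) ω ≤ s * (l + δ) := by linarith [not_lt.1 hlarge]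
            have := mul_le_mul_of_nonneg_left h3 hr0.le
            rwa [← mul_assoc, hrs] at this
          have := Real.exp_le_exp.2 h2
          linarith
      have i1 := h.chain.integrable (hdep (a + s) hn1 hnT)
      have i3 : Integrable (fun ω => W ω * Y ω) P := h.chain.integrable
        ((hWdep.mono (Nat.le_add_right a s)).comp₂ hYdep fun u v => u * v)
      have i2 := hWi.mul_const (1 + κ * ε / 8 + κ * ε / 16)
      have i23 : Integrable (fun ω => W ω * (1 + κ * ε / 8 + κ * ε / 16) + r * (W ω * Y ω)) P :=
        i2.add (i3.const_mul r)
      have hI := integral_mono i1 (i23.add (integrable_const (κ * ε / 16 * M))) hpt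
      simp only [Pi.add_apply] at hI
      rw [integral_add i23 (integrable_const _),
        integral_add i2 (i3.const_mul r), integral_mul_const, integral_const_mul, integral_const,
        probReal_univ, one_smul] at hI
      have hWM : ∫ ω, W ω ∂P ≤ M :=
        (integral_mono hWi (h.chain.integrable (hdep a ha haT)) hWle).trans ihM
      have hWY' := mul_le_mul_of_nonneg_left hWY hr0.le
      have e1 : r * (-(ε / 4 * s) * ∫ ω, W ω ∂P) = -(κ * ε / 4) * ∫ ω, W ω ∂P := by
        rw [← hrs]; ring
      -- The coefficient of the integral of `W` is now `1 + κ ε / 8 + κ ε / 16 - κ ε / 4 = 1 - κ ε /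
      -- 16`.
      have hfin := mul_le_mul_of_nonneg_left hWM (sub_nonneg.2 hγ1)
      linarith

/-- The exponential moment is turned into a first moment by `u + 1 ≤ exp u`. -/
theorem integral_Q_le_mul (h : ErgodicRun P X D Φ Φ' R F G H ε K π ξ m τ T f f' g g' x Q)
    (hT : 4 * H ≤ ε * T) {s n : ℕ} (hs1 : 1 ≤ s) (hs : (4 * H + 2 * ε) * τ ≤ ε * s)
    (hn1 : 1 ≤ n) (hn : n ≤ T + 1) (hms : (m : ℝ) * n ≤ s ^ 2) :
    ∫ ω, Q n ω ∂P ≤ expMoment R F G H ε / expRate H ε * s := by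
  have hκ := h.expRate_pos
  have hs0 : (0 : ℝ) < s := by exact_mod_cast hs1
  have h1 := h.integral_exp_le hT hs1 hs hn hms hn1 le_rfl
  have h2 : ∫ ω, expRate H ε / s * Q n ω ∂P ≤ ∫ ω, Real.exp (expRate H ε / s * Q n ω) ∂P :=
    integral_mono ((h.integrable_Q hn1 hn).const_mul _)
      (h.chain.integrable ((h.Q_dep hn1 hn).comp fun q => Real.exp (expRate H ε / s * q)))
      fun ω => by
        have := Real.add_one_le_exp (expRate H ε / s * Q n ω)
        show _ ≤ Real.exp _
        linarith
  rw [integral_const_mul] at h2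
  have h3 := h2.trans h1
  rw [div_mul_eq_mul_div, div_le_iff₀ hs0] at h3
  rw [div_mul_eq_mul_div, le_div_iff₀ hκ]
  linarith

theorem expMoment_pos (h : ErgodicRun P X D Φ Φ' R F G H ε K π ξ m τ T f f' g g' x Q) :
    0 < expMoment R F G H ε := by
  have := h.expRate_pos
  have := h.slack_pos
  unfold expMoment
  positivity

theorem sqrt_m_pos (h : ErgodicRun P X D Φ Φ' R F G H ε K π ξ m τ T f f' g g' x Q) :
    0 < √(m : ℝ) := Real.sqrt_pos.2 (by linarith [h.one_le_m_real])

theorem one_le_scale (h : ErgodicRun P X D Φ Φ' R F G H ε K π ξ m τ T f f' g g' x Q) {t : ℕ}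
    (ht : 1 ≤ t) : 1 ≤ (τ : ℝ) * √(t : ℝ) / √(m : ℝ) := by
  rw [le_div_iff₀ h.sqrt_m_pos, one_mul]
  have h1 : √(m : ℝ) ≤ m := Real.sqrt_le_iff.2 ⟨by positivity, by nlinarith [h.one_le_m_real]⟩
  have h2 : 1 ≤ √(t : ℝ) := Real.one_le_sqrt.2 (by exact_mod_cast ht)
  have := h.m_le_tau_real
  nlinarith [(Nat.cast_nonneg τ : (0 : ℝ) ≤ τ)]

theorem queueConst_nonneg (h : ErgodicRun P X D Φ Φ' R F G H ε K π ξ m τ T f f' g g' x Q) :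
    0 ≤ queueConst R F G H ε := by
  have := h.expRate_pos
  have := h.expMoment_pos
  have := h.delta_nonneg
  have := h.slack_pos
  have := h.H_pos
  unfold queueConst
  positivity

/-- The exponential moment is used only when the horizon is long enough for the bias `2 H / T` not
to spoil Slater's slack and when `t ≥ τ`. Otherwise the deterministic bound `Q t ≤ t (H + G R)`
suffices. -/
theorem integral_Q_le (h : ErgodicRun P X D Φ Φ' R F G H ε K π ξ m τ T f f' g g' x Q) {t : ℕ}
    (h1 : 1 ≤ t) (h2 : t ≤ T + 1) :
    ∫ ω, Q t ω ∂P ≤ queueConst R F G H ε * (τ * √(t : ℝ) / √(m : ℝ)) := by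
  have hκ := h.expRate_pos
  have hM := h.expMoment_pos
  have hδ := h.delta_nonneg
  have hε := h.slack_pos
  have hH := h.H_pos
  have hm := h.sqrt_m_pos
  have hmτ := h.m_le_tau_real
  have hm1 := h.one_le_m_real
  have hA := h.one_le_scale h1
  have ht1 : (1 : ℝ) ≤ t := by exact_mod_cast h1
  have hmm : √(m : ℝ) * √(m : ℝ) = m := Real.mul_self_sqrt (by linarith)
  have htt : √(t : ℝ) * √(t : ℝ) = t := Real.mul_self_sqrt (by linarith)
  have hττ : √(τ : ℝ) * √(τ : ℝ) = τ := Real.mul_self_sqrt (by linarith)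
  have hmτ' : √(m : ℝ) ≤ √(τ : ℝ) := Real.sqrt_le_sqrt hmτ
  have hst := Real.sqrt_nonneg (t : ℝ)
  set A := (τ : ℝ) * √(t : ℝ) / √(m : ℝ) with hAdef
  have p1 : 0 ≤ 3 * ⌈(4 * H + 2 * ε) / ε⌉₊ * (expMoment R F G H ε / expRate H ε) := by positivity
  have p3 : 0 ≤ 8 * H / ε * (H + G * R) := by positivity
  have hdet : ∀ c : ℝ, t * (H + G * R) ≤ c → ∫ ω, Q t ω ∂P ≤ c := fun c hc => by
    have := integral_mono (h.integrable_Q h1 h2) (integrable_const c)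
      fun ω => ((h.bounded ω).Q_le h1 h2).trans hc
    rwa [integral_const, probReal_univ, one_smul] at this
  unfold queueConst
  rcases le_or_gt (4 * H) (ε * T) with hT | hT
  · rcases le_or_gt τ t with hτt | hτt
    -- The window is `s = c (b + τ)`: the part `c τ` allows for mixing, and `b ≥ √(m t)` dominates
    -- the penalty. For `m ≤ τ ≤ t` it is at most `3 c A`.
    · set c := ⌈(4 * H + 2 * ε) / ε⌉₊ with hc
      have hc0 : (4 * H + 2 * ε) / ε ≤ c := Nat.le_ceil _
      have hc1 : (1 : ℝ) ≤ c := by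
        refine le_trans ?_ hc0
        rw [le_div_iff₀ hε]
        linarith
      set b := ⌈√((m : ℝ) * t)⌉₊ with hb
      have hb0 : √((m : ℝ) * t) ≤ b := Nat.le_ceil _
      have hb1 : (b : ℝ) ≤ √((m : ℝ) * t) + 1 := (Nat.ceil_lt_add_one (Real.sqrt_nonneg _)).le
      have hτ1 : 1 ≤ τ := h.one_le_m.trans h.m_le_tau
      have hcN : 1 ≤ c := by exact_mod_cast hc1
      have hs1 : 1 ≤ c * (b + τ) := Nat.one_le_iff_ne_zero.2 (by positivity)
      have hbτ : √((m : ℝ) * t) ≤ ((c * (b + τ) : ℕ) : ℝ) := by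
        push_cast
        have : (0 : ℝ) ≤ τ := Nat.cast_nonneg _
        nlinarith [Real.sqrt_nonneg ((m : ℝ) * t)]
      have key := h.integral_Q_le_mul hT hs1 (n := t) (by
          rw [div_le_iff₀ hε] at hc0
          push_cast
          have a1 : (0 : ℝ) ≤ b := Nat.cast_nonneg _
          have a2 : (0 : ℝ) ≤ τ := Nat.cast_nonneg _
          have a3 := mul_le_mul_of_nonneg_right hc0 a2
          have a4 : 0 ≤ ε * (c * b) := by positivity
          linarith) h1 h2 (by
          have := mul_self_le_mul_self (Real.sqrt_nonneg _) hbτ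
          rw [Real.mul_self_sqrt (by positivity)] at this
          linarith)
      have b1 : √((m : ℝ) * t) ≤ A := by
        rw [Real.sqrt_mul (by linarith), hAdef, le_div_iff₀ hm]
        calc √(m : ℝ) * √(t : ℝ) * √(m : ℝ) = m * √(t : ℝ) := by linear_combination √(t : ℝ) * hmm
          _ ≤ τ * √(t : ℝ) := mul_le_mul_of_nonneg_right hmτ hst
      have b2 : (τ : ℝ) ≤ A := by
        rw [hAdef, le_div_iff₀ hm]
        refine mul_le_mul_of_nonneg_left (Real.sqrt_le_sqrt ?_) (Nat.cast_nonneg _)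
        exact hmτ.trans (by exact_mod_cast hτt)
      have b3 : ((c * (b + τ) : ℕ) : ℝ) ≤ 3 * c * A := by
        push_cast
        have : (b : ℝ) + τ ≤ 3 * A := by linarith
        have := mul_le_mul_of_nonneg_left this (show (0 : ℝ) ≤ c by linarith)
        linarith
      refine key.trans ?_
      have b4 := mul_le_mul_of_nonneg_left b3 (show 0 ≤ expMoment R F G H ε / expRate H ε by
        positivity)
      have b5 : 0 ≤ ((H + G * R) + 8 * H / ε * (H + G * R)) * A := by positivity
      linarith
    · refine hdet _ ?_
      have b1 : (t : ℝ) ≤ A := by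
        rw [hAdef, le_div_iff₀ hm]
        have htτ : √(t : ℝ) ≤ √(τ : ℝ) := Real.sqrt_le_sqrt (by exact_mod_cast hτt.le)
        calc (t : ℝ) * √(m : ℝ)
          _ = √(t : ℝ) * (√(t : ℝ) * √(m : ℝ)) := by linear_combination -√(m : ℝ) * htt
          _ ≤ √(t : ℝ) * (√(τ : ℝ) * √(τ : ℝ)) := by gcongr
          _ = τ * √(t : ℝ) := by rw [hττ]; ring
      have b2 := mul_le_mul_of_nonneg_right b1 hδ
      have b3 := mul_nonneg (add_nonneg p1 p3) (zero_le_one.trans hA)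
      linarith
  · refine hdet _ ?_
    -- A short horizon: `t ≤ T + 1 ≤ 2 T` with `T < 4 H / ε`.
    have b1 : (t : ℝ) ≤ 8 * H / ε := by
      rw [le_div_iff₀ hε]
      have : (t : ℝ) ≤ T + 1 := by exact_mod_cast h2
      have : (4 : ℝ) ≤ T := by exact_mod_cast h.four_le
      nlinarith
    have b2 := mul_le_mul_of_nonneg_right b1 hδ
    have b3 := mul_le_mul_of_nonneg_left hA p3
    have b4 := mul_nonneg (add_nonneg p1 hδ) (zero_le_one.trans hA)
    linarith

end ErgodicRun

end Stochastic

/-! ### Expected regret and violation -/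

theorem integral_le_of_forall_le {Ω : Type*} [MeasurableSpace Ω] {P : Measure Ω}
    [IsProbabilityMeasure P] {Y : Ω → ℝ} {c : ℝ} (hY : Integrable Y P) (h : ∀ ω, Y ω ≤ c) :
    ∫ ω, Y ω ∂P ≤ c := by
  have := integral_mono hY (integrable_const c) h
  rwa [integral_const, probReal_univ, one_smul] at this

/-- The constant in the bound on the expected regret. -/
def regretConst (R F G H : ℝ) : ℝ :=
  2 * (3 * (H + G * R) * H + (F ^ 2 / 4 + (H + G * R) ^ 2 / 2)) + 2 * R ^ 2

/-- The constant in the bound on the expected movement of the iterates. -/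
def moveConst (R F G H ε : ℝ) : ℝ := F + G * queueConst R F G H ε

/-- The constant in the bound on the expected violation. -/
def violationConst (R F G H ε : ℝ) : ℝ :=
  2 * queueConst R F G H ε + 2 * G * moveConst R F G H ε

section Stochastic

variable {E : Type u} [NormedAddCommGroup E] [NormedSpace ℝ E]
  {S : Type v} [Fintype S] [DecidableEq S] [MeasurableSpace S] [MeasurableSingletonClass S]
  {Ω : Type w} [MeasurableSpace Ω]

namespace ErgodicRun

variable {P : Measure Ω} [IsProbabilityMeasure P] {X D : Set E} {Φ : E → ℝ} {Φ' : E → E →L[ℝ] ℝ}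
  {R F G H ε : ℝ} {K : Matrix S S ℝ} {π : S → ℝ} {ξ : ℕ → Ω → S} {m τ T : ℕ}
  {f : Ω → ℕ → E → ℝ} {f' : Ω → ℕ → E → E →L[ℝ] ℝ} {g : E → S → ℝ} {g' : E → S → E →L[ℝ] ℝ}
  {x : ℕ → Ω → E} {Q : ℕ → Ω → ℝ}

theorem loss_dep (h : ErgodicRun P X D Φ Φ' R F G H ε K π ξ m τ T f f' g g' x Q) {t : ℕ}
    (ht : t ∈ Finset.Icc 1 T) : PathDep ξ t fun ω => f ω t (x t ω) := by
  have ht' := Finset.mem_Icc.1 ht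
  intro ω ω' hω
  have h1 := (h.loss_eq t ht ω ω' (pathDep_self ht'.1 ω ω' hω)).1
  have h2 := h.x_dep ht'.1 (by omega) ω ω' hω
  simp only [h1, h2]

theorem loss_dep_const (h : ErgodicRun P X D Φ Φ' R F G H ε K π ξ m τ T f f' g g' x Q) {t : ℕ}
    (ht : t ∈ Finset.Icc 1 T) (y : E) : PathDep ξ t fun ω => f ω t y := fun ω ω' hω => by
  simp only [(h.loss_eq t ht ω ω' (pathDep_self (Finset.mem_Icc.1 ht).1 ω ω' hω)).1]

theorem eval_dep (h : ErgodicRun P X D Φ Φ' R F G H ε K π ξ m τ T f f' g g' x Q) {β : Type*}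
    (φ : E → S → β) {a t : ℕ} (ha : 1 ≤ a) (hat : a ≤ t) (ht : t ≤ T + 1) :
    PathDep ξ t fun ω => φ (x a ω) (ξ t ω) :=
  ((h.x_dep ha (hat.trans ht)).mono hat).comp₂ (pathDep_self (ha.trans hat)) φ

/-- Going back `τ` steps decouples the queue from the state. The change of queue costs `τ (H + G R)
H` and the imperfect mixing at most `2 (H + G R) H`; for `t ≤ τ` the queue itself is `O(τ)`. -/
theorem integral_Q_mul_le (h : ErgodicRun P X D Φ Φ' R F G H ε K π ξ m τ T f f' g g' x Q) {t : ℕ}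
    (ht : t ∈ Finset.Icc 1 T) {y : E} (hy : y ∈ X) (hyg : mean π (g y) ≤ 0) :
    ∫ ω, Q t ω * g y (ξ t ω) ∂P ≤ 3 * τ * (H + G * R) * H := by
  obtain ⟨h1, h2⟩ := Finset.mem_Icc.1 ht
  have hδ := h.delta_nonneg
  have hH := h.H_pos
  have hτ : (1 : ℝ) ≤ τ := h.one_le_m_real.trans h.m_le_tau_real
  have hdH : 0 ≤ (H + G * R) * H := mul_nonneg hδ hH.le
  have hint : Integrable (fun ω => Q t ω * g y (ξ t ω)) P :=
    h.chain.integrable ((h.Q_dep h1 (by omega)).comp₂ (pathDep_self h1) fun q s => q * g y s)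
  rcases le_or_gt t τ with htτ | htτ
  · refine (integral_le_of_forall_le (c := τ * (H + G * R) * H) hint fun ω => ?_).trans ?_
    · have a1 : Q t ω ≤ τ * (H + G * R) := ((h.bounded ω).Q_le h1 (by omega)).trans
        (mul_le_mul_of_nonneg_right (by exact_mod_cast htτ) hδ)
      exact (mul_le_mul_of_nonneg_left (le_of_abs_le (h.constr_bdd y hy _))
        ((h.bounded ω).Q_nonneg h1 (by omega))).trans (mul_le_mul_of_nonneg_right a1 hH.le)
    · nlinarith
  · obtain ⟨a, rfl⟩ := Nat.exists_eq_add_of_le' htτ.le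
    have ha : 1 ≤ a := by omega
    have hQa := h.Q_dep ha (by omega)
    have i1 : Integrable (fun ω => Q a ω * g y (ξ (a + τ) ω)) P :=
      h.chain.integrable ((hQa.mono (Nat.le_add_right a τ)).comp₂ (pathDep_self (by omega))
        fun q s => q * g y s)
    have e1 : ∫ ω, Q (a + τ) ω * g y (ξ (a + τ) ω) ∂P
        ≤ ∫ ω, (Q a ω * g y (ξ (a + τ) ω) + τ * (H + G * R) * H) ∂P := by
      refine integral_mono hint (i1.add (integrable_const _)) fun ω => ?_
      have a1 := (h.bounded ω).abs_Q_add_sub_le ha τ (by omega)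
      have a2 : (Q (a + τ) ω - Q a ω) * g y (ξ (a + τ) ω) ≤ τ * (H + G * R) * H := by
        refine (le_abs_self _).trans ?_
        rw [abs_mul]
        exact mul_le_mul a1 (h.constr_bdd y hy _) (abs_nonneg _) (by positivity)
      show _ ≤ _ + _
      linarith
    rw [integral_add i1 (integrable_const _), integral_const, probReal_univ, one_smul] at e1
    have e2 := h.chain.integral_mul_le h.ergodic h.stationary ha (one_div_pos.2 h.T_pos)
      (h.tau_eq ▸ le_rfl : tauMix K π (1 / (T : ℝ)) ≤ τ) hQa
      (fun ω => (h.bounded ω).Q_nonneg ha (by omega)) (h.constr_bdd y hy)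
    have e3 : ∫ ω, Q a ω ∂P ≤ T * (H + G * R) := by
      refine integral_le_of_forall_le (h.integrable_Q ha (by omega)) fun ω => ?_
      refine ((h.bounded ω).Q_le ha (by omega)).trans (mul_le_mul_of_nonneg_right ?_ hδ)
      exact_mod_cast (by omega : a ≤ T)
    have e4 : 0 ≤ ∫ ω, Q a ω ∂P :=
      integral_nonneg fun ω => (h.bounded ω).Q_nonneg ha (by omega)
    -- The mixing accuracy `1 / T` exactly offsets the linear a priori bound on the queue.
    have e5 : (mean π (g y) + 2 * H * (1 / (T : ℝ))) * ∫ ω, Q a ω ∂P ≤ 2 * ((H + G * R) * H) := by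
      have hT := h.T_pos
      calc (mean π (g y) + 2 * H * (1 / (T : ℝ))) * ∫ ω, Q a ω ∂P
          ≤ (2 * H * (1 / (T : ℝ))) * ∫ ω, Q a ω ∂P :=
            mul_le_mul_of_nonneg_right (by linarith) e4
        _ ≤ (2 * H * (1 / (T : ℝ))) * (T * (H + G * R)) :=
            mul_le_mul_of_nonneg_left e3 (by positivity)
        _ = 2 * ((H + G * R) * H) := by field_simp
    nlinarith

theorem sqrt_mul_eq (_ : ErgodicRun P X D Φ Φ' R F G H ε K π ξ m τ T f f' g g' x Q) (t : ℝ) :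
    √((m : ℝ) * t) = √(m : ℝ) * √t := Real.sqrt_mul (Nat.cast_nonneg m) t

theorem sqrt_succ_le (h : ErgodicRun P X D Φ Φ' R F G H ε K π ξ m τ T f f' g g' x Q) :
    √((T : ℝ) + 1) ≤ 2 * √(T : ℝ) := by
  have hT : (4 : ℝ) ≤ T := by exact_mod_cast h.four_le
  rw [Real.sqrt_le_left (by positivity), mul_pow, Real.sq_sqrt (by linarith)]
  linarith

theorem integral_regret_le (h : ErgodicRun P X D Φ Φ' R F G H ε K π ξ m τ T f f' g g' x Q) {y : E}
    (hy : y ∈ X) (hyg : mean π (g y) ≤ 0) :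
    ExpectationLE P (fun ω => ∑ t ∈ Finset.Icc 1 T, f ω t (x t ω) - ∑ t ∈ Finset.Icc 1 T, f ω t y)
      (regretConst R F G H * (τ * √(T : ℝ) / √(m : ℝ))) := by
  have hδ := h.delta_nonneg
  have hH := h.H_pos
  have hm := h.sqrt_m_pos
  have hτ : (1 : ℝ) ≤ τ := h.one_le_m_real.trans h.m_le_tau_real
  have hdH : 0 ≤ (H + G * R) * H := mul_nonneg hδ hH.le
  have hmm : √(m : ℝ) * √(m : ℝ) = m := Real.mul_self_sqrt (Nat.cast_nonneg m)
  simp only [← Finset.sum_sub_distrib]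
  have hint : Integrable (fun ω => ∑ t ∈ Finset.Icc 1 T, (f ω t (x t ω) - f ω t y)) P :=
    integrable_finsetSum _ fun t ht => (h.chain.integrable (h.loss_dep ht)).sub
      (h.chain.integrable (h.loss_dep_const ht y))
  refine ⟨hint, ?_⟩
  set B := F ^ 2 / 4 + (H + G * R) ^ 2 / 2 with hB
  have hB0 : 0 ≤ B := by positivity
  have iQ : ∀ t ∈ Finset.Icc 1 T, Integrable (fun ω => Q t ω * g y (ξ t ω)) P := fun t ht => by
    have ht' := Finset.mem_Icc.1 ht
    exact h.chain.integrable ((h.Q_dep ht'.1 (by omega)).comp₂ (pathDep_self ht'.1)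
      fun q s => q * g y s)
  have i1 : ∀ t ∈ Finset.Icc 1 T,
      Integrable (fun ω => (Q t ω * g y (ξ t ω) + B) / √(m * t)) P := fun t ht =>
    ((iQ t ht).add (integrable_const B)).div_const _
  have h1 := integral_mono hint ((integrable_finsetSum _ i1).add
    (integrable_const (√(m * (T + 1)) * R ^ 2))) fun ω => (h.bounded ω).regret_le hy
  simp only [Pi.add_apply] at h1
  rw [integral_add (integrable_finsetSum _ i1) (integrable_const _), integral_finsetSum _ i1,
    integral_const, probReal_univ, one_smul] at h1
  have h2 : ∀ t ∈ Finset.Icc 1 T, ∫ ω, (Q t ω * g y (ξ t ω) + B) / √(m * t) ∂P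
      ≤ (3 * (H + G * R) * H + B) * τ / √(m : ℝ) * (1 / √(t : ℝ)) := fun t ht => by
    rw [integral_div, integral_add (iQ t ht) (integrable_const B), integral_const, probReal_univ,
      one_smul, h.sqrt_mul_eq, div_mul_div_comm, mul_one]
    refine div_le_div_of_nonneg_right ?_ (by positivity)
    have := h.integral_Q_mul_le ht hy hyg
    nlinarith
  have h3 := Finset.sum_le_sum h2
  rw [← Finset.mul_sum] at h3
  have h4 := mul_le_mul_of_nonneg_left (sum_inv_sqrt_le T)
    (show 0 ≤ (3 * (H + G * R) * H + B) * τ / √(m : ℝ) by positivity)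
  have h5 : √((m : ℝ) * (T + 1)) * R ^ 2 ≤ 2 * R ^ 2 * (τ * √(T : ℝ) / √(m : ℝ)) := by
    rw [h.sqrt_mul_eq]
    have a1 : √(m : ℝ) ≤ τ / √(m : ℝ) := by
      rw [le_div_iff₀ hm, hmm]
      exact h.m_le_tau_real
    have a2 := mul_le_mul a1 h.sqrt_succ_le (Real.sqrt_nonneg _) (by positivity)
    have a3 := mul_le_mul_of_nonneg_right a2 (sq_nonneg R)
    refine a3.trans (le_of_eq ?_)
    ring
  refine h1.trans ((add_le_add (h3.trans h4) h5).trans (le_of_eq ?_))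
  rw [regretConst, ← hB]
  ring

theorem step_dep (h : ErgodicRun P X D Φ Φ' R F G H ε K π ξ m τ T f f' g g' x Q) {t : ℕ}
    (ht : t ∈ Finset.Icc 1 T) : PathDep ξ (t + 1) fun ω => ‖x (t + 1) ω - x t ω‖ := by
  have ht' := Finset.mem_Icc.1 ht
  exact (h.x_dep (by omega) (by omega)).comp₂
    ((h.x_dep ht'.1 (by omega)).mono (Nat.le_succ t)) fun a b => ‖a - b‖

theorem moveConst_nonneg (h : ErgodicRun P X D Φ Φ' R F G H ε K π ξ m τ T f f' g g' x Q) :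
    0 ≤ moveConst R F G H ε :=
  add_nonneg h.F_pos.le (mul_nonneg h.G_nonneg h.queueConst_nonneg)

/-- The queue bound divided by the step size has order `τ / (m √m √t)`; the loss contribution `F /
√(m t)` is absorbed in the same rate because `m ≤ τ`. -/
theorem integral_step_le (h : ErgodicRun P X D Φ Φ' R F G H ε K π ξ m τ T f f' g g' x Q) {t : ℕ}
    (ht : t ∈ Finset.Icc 1 T) :
    ∫ ω, ‖x (t + 1) ω - x t ω‖ ∂P
      ≤ moveConst R F G H ε * (τ / (m * √(m : ℝ))) * (1 / √(t : ℝ)) := by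
  obtain ⟨h1, h2⟩ := Finset.mem_Icc.1 ht
  have hQi := h.integrable_Q h1 (by omega)
  have hm := h.sqrt_m_pos
  have hm1 := h.one_le_m_real
  have hF := h.F_pos
  have hG := h.G_nonneg
  have hq := h.queueConst_nonneg
  have ht0 : (0 : ℝ) < t := by exact_mod_cast h1
  have hst : 0 < √(t : ℝ) := Real.sqrt_pos.2 ht0
  have htt : √(t : ℝ) * √(t : ℝ) = t := Real.mul_self_sqrt ht0.le
  have a1 := integral_mono (h.chain.integrable (h.step_dep ht))
    ((integrable_const (F / (2 * √(m * t)))).add ((hQi.const_mul G).div_const (2 * (m * t))))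
    fun ω => (h.bounded ω).norm_step_le ht
  simp only [Pi.add_apply] at a1
  rw [integral_add (integrable_const _) ((hQi.const_mul G).div_const _), integral_const,
    probReal_univ, one_smul, integral_div, integral_const_mul, h.sqrt_mul_eq] at a1
  have a2 := mul_le_mul_of_nonneg_left (h.integral_Q_le h1 (by omega)) hG
  have a3 := div_le_div_of_nonneg_right a2 (show (0 : ℝ) ≤ 2 * (m * t) by positivity)
  have a4 : G * (queueConst R F G H ε * (τ * √(t : ℝ) / √(m : ℝ))) / (2 * (m * t))
      = G * queueConst R F G H ε / 2 * (τ / (m * √(m : ℝ))) * (1 / √(t : ℝ)) := by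
    rw [show (2 : ℝ) * (m * t) = 2 * (m * (√(t : ℝ) * √(t : ℝ))) by rw [htt]]
    field_simp
  have a5 : F / (2 * (√(m : ℝ) * √(t : ℝ))) ≤ F * (τ / (m * √(m : ℝ))) * (1 / √(t : ℝ)) := by
    have b1 : F / (2 * (√(m : ℝ) * √(t : ℝ)))
        = F * (1 / √(m : ℝ)) * (1 / √(t : ℝ)) * (1 / 2) := by field_simp
    have b2 : F * (τ / (m * √(m : ℝ))) * (1 / √(t : ℝ))
        = F * (1 / √(m : ℝ)) * (1 / √(t : ℝ)) * (τ / m) := by field_simp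
    rw [b1, b2]
    refine mul_le_mul_of_nonneg_left ?_ (by positivity)
    rw [le_div_iff₀ (by linarith)]
    linarith [h.m_le_tau_real]
  have a6 : 0 ≤ G * queueConst R F G H ε / 2 * (τ / (m * √(m : ℝ))) * (1 / √(t : ℝ)) := by
    positivity
  rw [moveConst]
  linarith

theorem integrable_eval
    (h : ErgodicRun P X D Φ Φ' R F G H ε K π ξ m τ T f f' g g' x Q) {a t : ℕ} (ha : 1 ≤ a)
    (hat : a ≤ t) (ht : t ≤ T + 1) (φ : E → S → ℝ) :
    Integrable (fun ω => φ (x a ω) (ξ t ω)) P :=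
  h.chain.integrable (h.eval_dep φ ha hat ht)

theorem integral_violation_le (h : ErgodicRun P X D Φ Φ' R F G H ε K π ξ m τ T f f' g g' x Q) :
    ExpectationLE P (fun ω => ∑ t ∈ Finset.Icc 1 T, g (x t ω) (ξ t ω))
      (violationConst R F G H ε * (τ * √(T : ℝ) / √(m : ℝ))) := by
  have hm := h.sqrt_m_pos
  have hm1 := h.one_le_m_real
  have hG := h.G_nonneg
  have hq := h.queueConst_nonneg
  have hmv := h.moveConst_nonneg
  have hint : Integrable (fun ω => ∑ t ∈ Finset.Icc 1 T, g (x t ω) (ξ t ω)) P :=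
    integrable_finsetSum _ fun t ht =>
      h.integrable_eval (Finset.mem_Icc.1 ht).1 le_rfl
        (by have := (Finset.mem_Icc.1 ht).2; omega) g
  refine ⟨hint, ?_⟩
  have i1 := h.integrable_Q (t := T + 1) (by omega) le_rfl
  have i2 : ∀ t ∈ Finset.Icc 1 T, Integrable (fun ω => ‖x (t + 1) ω - x t ω‖) P := fun t ht =>
    h.chain.integrable (h.step_dep ht)
  have h1 := integral_mono hint (i1.add ((integrable_finsetSum _ i2).const_mul G))
    fun ω => (h.bounded ω).violation_le
  simp only [Pi.add_apply] at h1
  rw [integral_add i1 ((integrable_finsetSum _ i2).const_mul G), integral_const_mul,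
    integral_finsetSum _ i2] at h1
  have h2 := Finset.sum_le_sum fun t ht => h.integral_step_le (t := t) ht
  rw [← Finset.mul_sum] at h2
  have h3 := h2.trans (mul_le_mul_of_nonneg_left (sum_inv_sqrt_le T)
    (show 0 ≤ moveConst R F G H ε * (τ / (m * √(m : ℝ))) by positivity))
  have h4 : moveConst R F G H ε * (τ / (m * √(m : ℝ))) * (2 * √(T : ℝ))
      ≤ 2 * moveConst R F G H ε * (τ * √(T : ℝ) / √(m : ℝ)) := by
    have e : moveConst R F G H ε * (τ / (m * √(m : ℝ))) * (2 * √(T : ℝ))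
        = 2 * moveConst R F G H ε * (τ * √(T : ℝ) / √(m : ℝ)) / m := by field_simp
    rw [e]
    exact div_le_self (by positivity) hm1
  have h5 := mul_le_mul_of_nonneg_left (h3.trans h4) hG
  have h6 := h.integral_Q_le (t := T + 1) (by omega) le_rfl
  have h7 : (τ : ℝ) * √((T + 1 : ℕ) : ℝ) / √(m : ℝ) ≤ 2 * (τ * √(T : ℝ) / √(m : ℝ)) := by
    push_cast
    rw [← mul_div_assoc]
    refine div_le_div_of_nonneg_right ?_ hm.le
    have := mul_le_mul_of_nonneg_left h.sqrt_succ_le (Nat.cast_nonneg (α := ℝ) τ)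
    linarith
  have h8 := mul_le_mul_of_nonneg_left h7 hq
  rw [violationConst]
  linarith

end ErgodicRun

end Stochastic

/-! ### The average of the iterates -/

theorem sum_Icc_add_eq {M : Type*} [AddCommMonoid M] (a : ℕ → M) (n k : ℕ) :
    ∑ t ∈ Finset.Icc 1 (n + k), a t
      = ∑ t ∈ Finset.Icc 1 n, a t + ∑ t ∈ Finset.Icc 1 k, a (t + n) := by
  induction k with
  | zero => simp
  | succ k ih =>
    rw [← add_assoc, Finset.sum_Icc_succ_top (by omega), ih, Finset.sum_Icc_succ_top (by omega),
      add_assoc, show k + 1 + n = n + k + 1 by omega]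

section Stochastic

variable {E : Type u} [NormedAddCommGroup E] [NormedSpace ℝ E]
  {S : Type v} [Fintype S] [DecidableEq S] [MeasurableSpace S] [MeasurableSingletonClass S]
  {Ω : Type w} [MeasurableSpace Ω]

theorem norm_sub_le_sum (x : ℕ → E) (a k : ℕ) :
    ‖x a - x (a + k)‖ ≤ ∑ i ∈ Finset.range k, ‖x (a + i + 1) - x (a + i)‖ := by
  induction k with
  | zero => simp
  | succ k ih =>
    rw [Finset.sum_range_succ, norm_sub_rev (x (a + k + 1)), ← add_assoc]
    exact (norm_sub_le_norm_sub_add_norm_sub _ (x (a + k)) _).trans (by gcongr)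

theorem average_mem {X : Set E} (hX : Convex ℝ X) {x : ℕ → E} {T : ℕ} (hT : 1 ≤ T)
    (hx : ∀ t ∈ Finset.Icc 1 T, x t ∈ X) : average x T ∈ X := by
  have hT0 : (T : ℝ) ≠ 0 := by positivity
  rw [average, Finset.smul_sum]
  refine hX.sum_mem (fun _ _ => by positivity) ?_ hx
  simp [hT0]

theorem mean_average_le {X : Set E} {φ : E → S → ℝ} {π : S → ℝ} (hπ : π ∈ stdSimplex ℝ S)
    (hφ : ∀ s, ConvexOn ℝ X fun y => φ y s) {x : ℕ → E} {T : ℕ} (hT : 1 ≤ T)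
    (hx : ∀ t ∈ Finset.Icc 1 T, x t ∈ X) :
    mean π (φ (average x T)) ≤ 1 / (T : ℝ) * ∑ t ∈ Finset.Icc 1 T, mean π (φ (x t)) := by
  have hT0 : (T : ℝ) ≠ 0 := by positivity
  have h1 : ∀ s, φ (average x T) s ≤ ∑ t ∈ Finset.Icc 1 T, 1 / (T : ℝ) * φ (x t) s := fun s => by
    rw [average, Finset.smul_sum]
    exact (hφ s).map_sum_le (fun _ _ => by positivity) (by simp [hT0]) hx
  calc mean π (φ (average x T))
      ≤ ∑ s, π s * ∑ t ∈ Finset.Icc 1 T, 1 / (T : ℝ) * φ (x t) s :=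
        Finset.sum_le_sum fun s _ => mul_le_mul_of_nonneg_left (h1 s) (hπ.1 s)
    _ = 1 / (T : ℝ) * ∑ t ∈ Finset.Icc 1 T, mean π (φ (x t)) := by
        simp only [mean, Finset.mul_sum]
        rw [Finset.sum_comm]
        refine Finset.sum_congr rfl fun t _ => Finset.sum_congr rfl fun s _ => by ring

namespace ErgodicRun

variable {P : Measure Ω} [IsProbabilityMeasure P] {X D : Set E} {Φ : E → ℝ} {Φ' : E → E →L[ℝ] ℝ}
  {R F G H ε : ℝ} {K : Matrix S S ℝ} {π : S → ℝ} {ξ : ℕ → Ω → S} {m τ T : ℕ}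
  {f : Ω → ℕ → E → ℝ} {f' : Ω → ℕ → E → E →L[ℝ] ℝ} {g : E → S → ℝ} {g' : E → S → E →L[ℝ] ℝ}
  {x : ℕ → Ω → E} {Q : ℕ → Ω → ℝ}

/-- A function evaluated at the iterates in stationary expectation is compared with its observed
value `τ` steps later. -/
theorem integral_mean_iterate_le
    (h : ErgodicRun P X D Φ Φ' R F G H ε K π ξ m τ T f f' g g' x Q) {φ : E → S → ℝ}
    {φ' : E → S → E →L[ℝ] ℝ} {L B : ℝ} (hL : 0 ≤ L)
    (hφ : ∀ s, IsDiffConvexOn X (fun y => φ y s) (fun y => φ' y s))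
    (hφ' : ∀ y ∈ X, ∀ s, ‖φ' y s‖ ≤ L) (hB : ∀ y ∈ X, ∀ s, |φ y s| ≤ B) {t : ℕ} (ht : 1 ≤ t)
    (htT : t + τ ≤ T) :
    ∫ ω, mean π (φ (x t ω)) ∂P ≤ ∫ ω, φ (x (t + τ) ω) (ξ (t + τ) ω) ∂P
      + L * (τ * (moveConst R F G H ε * (τ / (m * √(m : ℝ))) * (1 / √(t : ℝ))))
      + 2 * B * (1 / (T : ℝ)) := by
  have hx : ∀ i, 1 ≤ i → i ≤ T + 1 → ∀ ω, x i ω ∈ X := fun i h1 h2 ω => (h.bounded ω).mem h1 h2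
  -- Mixing with the iterate frozen at time `t`; the Lipschitz bound below then moves it to time `t
  -- + τ`.
  have h1 := h.chain.integral_mean_le h.ergodic h.stationary ht (one_div_pos.2 h.T_pos)
    (h.tau_eq ▸ le_rfl : tauMix K π (1 / (T : ℝ)) ≤ τ) (h.x_dep ht (by omega)) (h := φ)
    fun ω s => hB _ (hx t ht (by omega) ω) s
  have hmem : ∀ i ∈ Finset.range τ, t + i ∈ Finset.Icc 1 T := fun i hi => by
    have := Finset.mem_range.1 hi
    exact Finset.mem_Icc.2 ⟨by omega, by omega⟩
  have i1 := h.integrable_eval (a := t + τ) (t := t + τ) (by omega) le_rfl (by omega) φ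
  have i2 : ∀ i ∈ Finset.range τ, Integrable (fun ω => ‖x (t + i + 1) ω - x (t + i) ω‖) P :=
    fun i hi => h.chain.integrable (h.step_dep (hmem i hi))
  have h2 := integral_mono (h.integrable_eval ht (Nat.le_add_right t τ) (by omega) φ)
    (i1.add ((integrable_finsetSum _ i2).const_mul L)) fun ω => by
      have a1 := (hφ (ξ (t + τ) ω)).sub_le (fun y hy => hφ' y hy _) (hx t ht (by omega) ω)
        (hx (t + τ) (by omega) (by omega) ω)
      have a2 := mul_le_mul_of_nonneg_left (norm_sub_le_sum (fun i => x i ω) t τ) hL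
      simp only [Pi.add_apply]
      linarith
  simp only [Pi.add_apply] at h2
  rw [integral_add i1 ((integrable_finsetSum _ i2).const_mul L), integral_const_mul,
    integral_finsetSum _ i2] at h2
  have hm := h.sqrt_m_pos
  have hmv := h.moveConst_nonneg
  have h3 : ∀ i ∈ Finset.range τ, ∫ ω, ‖x (t + i + 1) ω - x (t + i) ω‖ ∂P
      ≤ moveConst R F G H ε * (τ / (m * √(m : ℝ))) * (1 / √(t : ℝ)) := fun i hi => by
    refine (h.integral_step_le (hmem i hi)).trans (mul_le_mul_of_nonneg_left ?_ (by positivity))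
    refine one_div_le_one_div_of_le (Real.sqrt_pos.2 (by exact_mod_cast ht))
      (Real.sqrt_le_sqrt ?_)
    exact_mod_cast Nat.le_add_right t i
  have h4 := Finset.sum_le_sum h3
  rw [Finset.sum_const, Finset.card_range, nsmul_eq_mul] at h4
  have h5 := mul_le_mul_of_nonneg_left h4 hL
  linarith

/-- A bound on the sum of the observed values of a function at the iterates gives a bound on its
stationary expectation at the average of the iterates. -/
theorem integral_mean_average_le
    (h : ErgodicRun P X D Φ Φ' R F G H ε K π ξ m τ T f f' g g' x Q) {φ : E → S → ℝ}
    {φ' : E → S → E →L[ℝ] ℝ} {L B A : ℝ} (hL : 0 ≤ L) (hA : 0 ≤ A)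
    (hφ : ∀ s, IsDiffConvexOn X (fun y => φ y s) (fun y => φ' y s))
    (hφ' : ∀ y ∈ X, ∀ s, ‖φ' y s‖ ≤ L) (hB : ∀ y ∈ X, ∀ s, |φ y s| ≤ B)
    (hsum : ∫ ω, ∑ t ∈ Finset.Icc 1 T, φ (x t ω) (ξ t ω) ∂P ≤ A * (τ * √(T : ℝ) / √(m : ℝ))) :
    ExpectationLE P (fun ω => mean π (φ (average (fun t => x t ω) T)))
      ((A + 4 * B + 2 * L * moveConst R F G H ε)
        * ((τ : ℝ) ^ 2 / ((m : ℝ) * √(m : ℝ) * √(T : ℝ)))) := by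
  have hT := h.T_pos
  have hT4 := h.four_le
  have hm := h.sqrt_m_pos
  have hm1 := h.one_le_m_real
  have hmτ := h.m_le_tau_real
  have hmv := h.moveConst_nonneg
  have hX : Convex ℝ X := let ⟨ω⟩ := h.nonempty; (h.bounded ω).convex
  have hx : ∀ i, 1 ≤ i → i ≤ T + 1 → ∀ ω, x i ω ∈ X := fun i h1 h2 ω => (h.bounded ω).mem h1 h2
  have hxI : ∀ ω, ∀ t ∈ Finset.Icc 1 T, x t ω ∈ X := fun ω t ht => by
    have := Finset.mem_Icc.1 ht
    exact hx t this.1 (by omega) ω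
  have hB0 : 0 ≤ B := by
    obtain ⟨z, hz, _⟩ := h.slater
    obtain ⟨s⟩ := h.stationary.nonempty
    exact (abs_nonneg _).trans (hB z hz s)
  have hmean : ∀ y ∈ X, mean π (φ y) ≤ B := fun y hy =>
    mean_le_of_forall_le h.stationary.mem_simplex fun s => le_of_abs_le (hB y hy s)
  have hsT : 0 < √(T : ℝ) := Real.sqrt_pos.2 hT
  have hTT : √(T : ℝ) * √(T : ℝ) = T := Real.mul_self_sqrt hT.le
  have hmm : √(m : ℝ) * √(m : ℝ) = m := Real.mul_self_sqrt (by linarith)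
  have hdep : PathDep ξ T fun ω => average (fun t => x t ω) T := fun ω ω' hω => by
    simp only [average]
    congr 1
    refine Finset.sum_congr rfl fun t ht => ?_
    have := Finset.mem_Icc.1 ht
    exact (h.x_dep this.1 (by omega)).mono this.2 ω ω' hω
  have hint : Integrable (fun ω => mean π (φ (average (fun t => x t ω) T))) P :=
    h.chain.integrable (hdep.comp fun y => mean π (φ y))
  refine ⟨hint, ?_⟩
  set Z := (τ : ℝ) ^ 2 / ((m : ℝ) * √(m : ℝ) * √(T : ℝ)) with hZ
  have hZ0 : 0 ≤ Z := by positivity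
  have hτ0 : (0 : ℝ) ≤ τ := Nat.cast_nonneg τ
  have hZ1 : (τ : ℝ) * √(T : ℝ) / √(m : ℝ) ≤ T * Z := by
    have e1 : T * Z = (τ : ℝ) * √(T : ℝ) / √(m : ℝ) * (τ / m) := by
      rw [hZ]
      nth_rewrite 1 [← hTT]
      field_simp
    rw [e1]
    refine le_mul_of_one_le_right (by positivity) ?_
    rw [le_div_iff₀ (by linarith)]
    linarith
  rcases le_or_gt T τ with hτT | hτT
  -- For `T ≤ τ` the target rate `Z` is at least `1`, so the uniform bound `B` is enough.
  · refine (integral_le_of_forall_le hint fun ω => hmean _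
      (average_mem hX (by omega) (hxI ω))).trans ?_
    have hZ2 : 1 ≤ Z := by
      rw [hZ, le_div_iff₀ (by positivity), one_mul]
      have a1 : √(m : ℝ) ≤ √(τ : ℝ) := Real.sqrt_le_sqrt hmτ
      have a2 : √(T : ℝ) ≤ √(τ : ℝ) := Real.sqrt_le_sqrt (by exact_mod_cast hτT)
      calc (m : ℝ) * √(m : ℝ) * √(T : ℝ) ≤ τ * √(τ : ℝ) * √(τ : ℝ) := by gcongr
        _ = (τ : ℝ) ^ 2 := by rw [mul_assoc, Real.mul_self_sqrt hτ0, sq]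
    have p1 : 0 ≤ (A + 3 * B + 2 * L * moveConst R F G H ε) * Z := by positivity
    have p2 := mul_le_mul_of_nonneg_left hZ2 hB0
    linarith
  · obtain ⟨k, hk⟩ := Nat.exists_eq_add_of_le hτT.le
    have hZ3 : (τ : ℝ) ≤ T * Z := by
      refine le_trans ?_ hZ1
      rw [le_div_iff₀ hm]
      exact mul_le_mul_of_nonneg_left
        (Real.sqrt_le_sqrt (hmτ.trans (by exact_mod_cast hτT.le))) hτ0
    have im : ∀ t ∈ Finset.Icc 1 T, Integrable (fun ω => mean π (φ (x t ω))) P := fun t ht => by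
      have := Finset.mem_Icc.1 ht
      exact h.chain.integrable ((h.x_dep this.1 (by omega)).comp fun y => mean π (φ y))
    have iv : ∀ t ∈ Finset.Icc 1 T, Integrable (fun ω => φ (x t ω) (ξ t ω)) P := fun t ht => by
      have := Finset.mem_Icc.1 ht
      exact h.integrable_eval this.1 le_rfl (by omega) φ
    have h1 := integral_mono hint ((integrable_finsetSum _ im).const_mul (1 / (T : ℝ))) fun ω =>
      mean_average_le h.stationary.mem_simplex (fun s => (hφ s).convexOn) (by omega : 1 ≤ T)
        (hxI ω)
    rw [integral_const_mul, integral_finsetSum _ im] at h1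
    -- The comparison shifts time by `τ`, so the last `τ` stationary means and the first `τ`
    -- observed values have no partner; each block costs `τ B`.
    have h2 : ∑ t ∈ Finset.Icc 1 T, ∫ ω, mean π (φ (x t ω)) ∂P
        ≤ ∑ t ∈ Finset.Icc 1 k, ∫ ω, mean π (φ (x t ω)) ∂P + τ * B := by
      rw [hk, add_comm τ k, sum_Icc_add_eq]
      refine add_le_add le_rfl ((Finset.sum_le_sum fun t ht => ?_).trans
        (le_of_eq (by simp : ∑ _t ∈ Finset.Icc 1 τ, B = τ * B)))
      have := Finset.mem_Icc.1 ht
      exact integral_le_of_forall_le (im _ (Finset.mem_Icc.2 ⟨by omega, by omega⟩))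
        fun ω => hmean _ (hx _ (by omega) (by omega) ω)
    have h3 : ∑ t ∈ Finset.Icc 1 k, ∫ ω, φ (x (t + τ) ω) (ξ (t + τ) ω) ∂P
        ≤ A * (τ * √(T : ℝ) / √(m : ℝ)) + τ * B := by
      rw [integral_finsetSum _ iv, hk, sum_Icc_add_eq, ← hk] at hsum
      have : -(τ * B) ≤ ∑ t ∈ Finset.Icc 1 τ, ∫ ω, φ (x t ω) (ξ t ω) ∂P := by
        refine (le_of_eq (by simp : -(τ * B) = ∑ _t ∈ Finset.Icc 1 τ, -B)).trans
          (Finset.sum_le_sum fun t ht => ?_)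
        have ht' := Finset.mem_Icc.1 ht
        have a1 := integral_mono (integrable_const (-B))
          (iv t (Finset.mem_Icc.2 ⟨ht'.1, by omega⟩)) fun ω =>
            (abs_le.1 (hB _ (hx t ht'.1 (by omega) ω) (ξ t ω))).1
        rwa [integral_const, probReal_univ, one_smul] at a1
      linarith
    have h4 := Finset.sum_le_sum fun t (ht : t ∈ Finset.Icc 1 k) =>
      h.integral_mean_iterate_le hL hφ hφ' hB (Finset.mem_Icc.1 ht).1
        (by have := (Finset.mem_Icc.1 ht).2; omega)
    rw [Finset.sum_add_distrib, Finset.sum_add_distrib, Finset.sum_const, Nat.card_Icc,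
      ← Finset.mul_sum, ← Finset.mul_sum, ← Finset.mul_sum, nsmul_eq_mul,
      Nat.add_sub_cancel] at h4
    have h5 : (k : ℝ) * (2 * B * (1 / (T : ℝ))) ≤ 2 * B := by
      have : (k : ℝ) ≤ T := by exact_mod_cast (by omega : k ≤ T)
      calc (k : ℝ) * (2 * B * (1 / (T : ℝ))) = 2 * B * (k / T) := by ring
        _ ≤ 2 * B * 1 := mul_le_mul_of_nonneg_left ((div_le_one hT).2 this) (by positivity)
        _ = 2 * B := mul_one _
    have h6 : ∑ t ∈ Finset.Icc 1 k, 1 / √(t : ℝ) ≤ 2 * √(T : ℝ) :=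
      (sum_inv_sqrt_le k).trans (mul_le_mul_of_nonneg_left
        (Real.sqrt_le_sqrt (by exact_mod_cast (by omega : k ≤ T))) (by norm_num))
    have h7 : L * (τ * (moveConst R F G H ε * (τ / (m * √(m : ℝ)))
        * ∑ t ∈ Finset.Icc 1 k, 1 / √(t : ℝ))) ≤ 2 * L * moveConst R F G H ε * (T * Z) := by
      have e1 : 2 * L * moveConst R F G H ε * (T * Z)
          = L * (τ * (moveConst R F G H ε * (τ / (m * √(m : ℝ))) * (2 * √(T : ℝ)))) := by
        rw [hZ]
        nth_rewrite 1 [← hTT]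
        field_simp
      rw [e1]
      gcongr
    have hτ1 : (1 : ℝ) ≤ τ := hm1.trans hmτ
    have h8 := mul_le_mul_of_nonneg_left hZ1 hA
    have h9 : τ * B + τ * B + 2 * B ≤ 4 * B * (T * Z) := by
      have b1 := mul_le_mul_of_nonneg_left hZ3 hB0
      have b2 := mul_le_mul_of_nonneg_left hτ1 hB0
      linarith
    refine h1.trans ?_
    rw [one_div, inv_mul_le_iff₀ hT]
    linarith

end ErgodicRun

end Stochastic

/-! ### The main bounds -/

theorem ExpectationLE.mono {Ω : Type*} [MeasurableSpace Ω] {P : Measure Ω} {Y : Ω → ℝ} {a b : ℝ}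
    (h : ExpectationLE P Y a) (hab : a ≤ b) : ExpectationLE P Y b :=
  ⟨h.1, h.2.trans hab⟩

/-- A constant that dominates the constants of all four bounds. -/
def totalConst (R F G H ε : ℝ) : ℝ :=
  regretConst R F G H + violationConst R F G H ε
    + (regretConst R F G H + 4 * (F * R) + 2 * F * moveConst R F G H ε)
    + (violationConst R F G H ε + 4 * H + 2 * G * moveConst R F G H ε)

section Const

variable {R F G H ε : ℝ}

theorem moveConst_pos (hR : 0 < R) (hF : 0 < F) (hG : 0 < G) (hH : 0 < H) (hε : 0 < ε) :
    0 < moveConst R F G H ε := by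
  unfold moveConst queueConst expMoment expRate
  positivity

theorem violationConst_pos (hR : 0 < R) (hF : 0 < F) (hG : 0 < G) (hH : 0 < H) (hε : 0 < ε) :
    0 < violationConst R F G H ε := by
  have := moveConst_pos hR hF hG hH hε
  unfold violationConst queueConst expMoment expRate
  positivity

theorem regretConst_pos (hR : 0 < R) (hF : 0 < F) (hG : 0 < G) (hH : 0 < H) :
    0 < regretConst R F G H := by
  unfold regretConst
  positivity

end Const

/-- The left side equals `τ T / √(m T)`, so the violation has the regret rate and the summand `τ ^ 2
/ √(m T)` is slack. -/
theorem scale_le_violation_scale {m τ T : ℝ} (hm : 0 ≤ m) (hτ : 0 ≤ τ) (hT : 0 < T) :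
    τ * √T / √m ≤ τ * (τ + T) / √(m * T) := by
  have hsT : 0 < √T := Real.sqrt_pos.2 hT
  have hTT : √T * √T = T := Real.mul_self_sqrt hT.le
  have e : τ * √T / √m = τ * T / √(m * T) := by
    rw [Real.sqrt_mul hm, ← mul_div_mul_right _ _ hsT.ne', mul_assoc, hTT]
  rw [e]
  refine div_le_div_of_nonneg_right (mul_le_mul_of_nonneg_left ?_ hτ) (Real.sqrt_nonneg _)
  linarith

theorem rpow_three_halves {a : ℝ} (ha : 0 < a) : a ^ (3 / 2 : ℝ) = a * √a := by
  rw [show (3 / 2 : ℝ) = 1 + 1 / 2 by norm_num, Real.rpow_add ha, Real.rpow_one,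
    Real.sqrt_eq_rpow]

end EDPP

end

theorem theorem3 (R F G H ε : ℝ) (hR : 0 < R) (hF : 0 < F) (hG : 0 < G) (hH : 0 < H)
    (hε : 0 < ε) :
    ∃ C : ℝ, 0 < C ∧
      ∀ (E : Type u) [NormedAddCommGroup E] [NormedSpace ℝ E] [FiniteDimensional ℝ E]
        (S : Type v) [Fintype S] [DecidableEq S] [MeasurableSpace S] [MeasurableSingletonClass S]
        (Ω : Type w) [MeasurableSpace Ω] (P : Measure Ω) [IsProbabilityMeasure P]
        -- the domain and the mirror map
        (X D : Set E) (Φ : E → ℝ) (Φ' : E → E →L[ℝ] ℝ)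
        -- the ergodic Markov chain
        (K : Matrix S S ℝ) (π : S → ℝ) (ξ : ℕ → Ω → S)
        -- the constraint functions and their gradients, the initial iterate and the horizon
        (g : E → S → ℝ) (g' : E → S → E →L[ℝ] ℝ) (x₁ : E) (T : ℕ),
      IsCompact X → Convex ℝ X → EDPP.IsMirrorMap X D Φ Φ' R →
      EDPP.IsErgodic K → EDPP.IsStationary K π → EDPP.IsMarkovChain P K ξ →
      (∀ s, EDPP.IsDiffConvexOn X (fun y => g y s) (fun y => g' y s)) →
      (∀ y ∈ X, ∀ s, ‖g' y s‖ ≤ G) → (∀ y ∈ X, ∀ s, |g y s| ≤ H) →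
      -- Slater's condition
      (∃ z ∈ X, EDPP.mean π (g z) ≤ -ε) →
      x₁ ∈ X → 4 ≤ T →
      ∀ m τ : ℕ, m = EDPP.tauMix K π (1 / 4) → τ = EDPP.tauMix K π (1 / (T : ℝ)) →
      -- online convex optimization with ergodic constraints: arbitrary losses `f t`
      (∀ (f : ℕ → E → ℝ) (f' : ℕ → E → E →L[ℝ] ℝ) (xstar : E)
          (x : ℕ → Ω → E) (Q : ℕ → Ω → ℝ),
        (∀ t ∈ Finset.Icc 1 T, EDPP.IsDiffConvexOn X (f t) (f' t)) →
        (∀ t ∈ Finset.Icc 1 T, ∀ y ∈ X, ‖f' t y‖ ≤ F) →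
        EDPP.IsConstrainedMin X (fun y => ∑ t ∈ Finset.Icc 1 T, f t y)
          (fun y => EDPP.mean π (g y)) xstar →
        (∀ ω, EDPP.IsRun X Φ Φ' m (1 / 2) T x₁ f'
          (fun t y => g y (ξ t ω)) (fun t y => g' y (ξ t ω))
          (fun t => x t ω) (fun t => Q t ω)) →
        EDPP.ExpectationLE P
          (fun ω => ∑ t ∈ Finset.Icc 1 T, f t (x t ω) - ∑ t ∈ Finset.Icc 1 T, f t xstar)
          (C * ((τ : ℝ) * √(T : ℝ) / √(m : ℝ))) ∧
        EDPP.ExpectationLE P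
          (fun ω => ∑ t ∈ Finset.Icc 1 T, g (x t ω) (ξ t ω))
          (C * ((τ : ℝ) * ((τ : ℝ) + (T : ℝ)) / √((m : ℝ) * (T : ℝ))))) ∧
      -- stochastic-constrained stochastic optimization: the losses are `f (·) (ξ t)`
      (∀ (f : E → S → ℝ) (f' : E → S → E →L[ℝ] ℝ) (xsharp : E)
          (x : ℕ → Ω → E) (Q : ℕ → Ω → ℝ),
        (∀ s, EDPP.IsDiffConvexOn X (fun y => f y s) (fun y => f' y s)) →
        (∀ y ∈ X, ∀ s, ‖f' y s‖ ≤ F) →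
        EDPP.IsConstrainedMin X (fun y => EDPP.mean π (f y))
          (fun y => EDPP.mean π (g y)) xsharp →
        (∀ ω, EDPP.IsRun X Φ Φ' m (1 / 2) T x₁ (fun t y => f' y (ξ t ω))
          (fun t y => g y (ξ t ω)) (fun t y => g' y (ξ t ω))
          (fun t => x t ω) (fun t => Q t ω)) →
        EDPP.ExpectationLE P
          (fun ω => ∑ t ∈ Finset.Icc 1 T, f (x t ω) (ξ t ω)
            - ∑ t ∈ Finset.Icc 1 T, f xsharp (ξ t ω))
          (C * ((τ : ℝ) * √(T : ℝ) / √(m : ℝ))) ∧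
        EDPP.ExpectationLE P
          (fun ω => ∑ t ∈ Finset.Icc 1 T, g (x t ω) (ξ t ω))
          (C * ((τ : ℝ) * ((τ : ℝ) + (T : ℝ)) / √((m : ℝ) * (T : ℝ)))) ∧
        EDPP.ExpectationLE P
          (fun ω => EDPP.mean π (f (EDPP.average (fun t => x t ω) T))
            - EDPP.mean π (f xsharp))
          (C * ((τ : ℝ) ^ 2 / ((m : ℝ) ^ (3 / 2 : ℝ) * √(T : ℝ))
            + (τ : ℝ) ^ (5 / 2 : ℝ) / ((m : ℝ) ^ (3 / 2 : ℝ) * (T : ℝ)))) ∧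
        EDPP.ExpectationLE P
          (fun ω => EDPP.mean π (g (EDPP.average (fun t => x t ω) T)))
          (C * ((τ : ℝ) ^ 2 / ((m : ℝ) ^ (3 / 2 : ℝ) * √(T : ℝ))
            + (τ : ℝ) ^ (5 / 2 : ℝ) / ((m : ℝ) ^ (3 / 2 : ℝ) * (T : ℝ))
            + (τ : ℝ) ^ 2 / ((m : ℝ) ^ (1 / 2 : ℝ) * (T : ℝ) ^ (3 / 2 : ℝ))))) := by
  refine ⟨EDPP.totalConst R F G H ε, ?_, ?_⟩
  · have := EDPP.moveConst_pos hR hF hG hH hε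
    have := EDPP.violationConst_pos hR hF hG hH hε
    have := EDPP.regretConst_pos hR hF hG hH
    unfold EDPP.totalConst
    positivity
  intro E _ _ _ S _ _ _ _ Ω _ P _ X D Φ Φ' K π ξ g g' x₁ T _ hX hΦ hK hπ hξ hg hg' hgH hslater hx₁
    hT m τ hm hτ
  have c1 := EDPP.moveConst_pos hR hF hG hH hε
  have c2 := EDPP.violationConst_pos hR hF hG hH hε
  have c3 := EDPP.regretConst_pos hR hF hG hH
  have hm1 : 1 ≤ m := hm ▸ (EDPP.tauMix_spec hK hπ (by norm_num)).1
  have hm0 : (0 : ℝ) < m := by exact_mod_cast hm1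
  have hT0 : (0 : ℝ) < T := by exact_mod_cast (by omega : 0 < T)
  have hscale := EDPP.scale_le_violation_scale hm0.le (Nat.cast_nonneg (α := ℝ) τ) hT0
  have hA0 : 0 ≤ (τ : ℝ) * √(T : ℝ) / √(m : ℝ) := by positivity
  have hR1 : EDPP.regretConst R F G H * ((τ : ℝ) * √(T : ℝ) / √(m : ℝ))
      ≤ EDPP.totalConst R F G H ε * ((τ : ℝ) * √(T : ℝ) / √(m : ℝ)) := by
    refine mul_le_mul_of_nonneg_right ?_ hA0
    rw [EDPP.totalConst]
    nlinarith [mul_pos hF hR, mul_pos hF c1, mul_pos hG c1]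
  have hV1 : EDPP.violationConst R F G H ε * ((τ : ℝ) * √(T : ℝ) / √(m : ℝ))
      ≤ EDPP.totalConst R F G H ε
        * ((τ : ℝ) * ((τ : ℝ) + (T : ℝ)) / √((m : ℝ) * (T : ℝ))) := by
    refine mul_le_mul ?_ hscale hA0 (by unfold EDPP.totalConst; positivity)
    rw [EDPP.totalConst]
    nlinarith [mul_pos hF hR, mul_pos hF c1, mul_pos hG c1]
  have hrun : ∀ (f : Ω → ℕ → E → ℝ) (f' : Ω → ℕ → E → E →L[ℝ] ℝ) (x : ℕ → Ω → E)
      (Q : ℕ → Ω → ℝ),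
      (∀ ω, ∀ t ∈ Finset.Icc 1 T, EDPP.IsDiffConvexOn X (f ω t) (f' ω t)) →
      (∀ ω, ∀ t ∈ Finset.Icc 1 T, ∀ y ∈ X, ‖f' ω t y‖ ≤ F) →
      (∀ t ∈ Finset.Icc 1 T, ∀ ω ω', ξ t ω = ξ t ω' → f ω t = f ω' t ∧ f' ω t = f' ω' t) →
      (∀ ω, EDPP.IsRun X Φ Φ' m (1 / 2) T x₁ (f' ω) (fun t y => g y (ξ t ω))
        (fun t y => g' y (ξ t ω)) (fun t => x t ω) (fun t => Q t ω)) →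
      EDPP.ErgodicRun P X D Φ Φ' R F G H ε K π ξ m τ T f f' g g' x Q := by
    intro f f' x Q hf hf' hdep hr
    exact
      { F_pos := hF
        H_pos := hH
        slack_pos := hε
        bounded := fun ω =>
          { convex := hX
            mirror := hΦ
            loss := hf ω
            loss_grad := hf' ω
            constr := fun t => hg (ξ t ω)
            constr_grad := fun t y hy => hg' y hy (ξ t ω)
            constr_bdd := fun t y hy => hgH y hy (ξ t ω)
            init_mem := (hr ω).init_x ▸ hx₁
            m_pos := hm1
            R_nonneg := hR.le
            F_nonneg := hF.le
            G_nonneg := hG.le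
            H_nonneg := hH.le
            run := (hr ω).init_x ▸ hr ω }
        constr := hg
        constr_grad := hg'
        constr_bdd := hgH
        slater := hslater
        init_eq := fun ω ω' => (hr ω).init_x.trans (hr ω').init_x.symm
        loss_eq := hdep
        ergodic := hK
        stationary := hπ
        chain := hξ
        four_le := hT
        m_eq := hm
        tau_eq := hτ }
  refine ⟨?_, ?_⟩
  · intro f f' xstar x Q hf hf' hmin hr
    have h := hrun (fun _ => f) (fun _ => f') x Q (fun _ => hf) (fun _ => hf')
      (fun _ _ _ _ _ => ⟨rfl, rfl⟩) hr
    exact ⟨(h.integral_regret_le hmin.1 hmin.2.1).mono hR1, h.integral_violation_le.mono hV1⟩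
  · intro f f' xsharp x Q hf hf' hmin hr
    have h := hrun (fun ω t y => f y (ξ t ω)) (fun ω t y => f' y (ξ t ω)) x Q
      (fun ω t _ => hf (ξ t ω)) (fun ω t _ y hy => hf' y hy (ξ t ω))
      (fun t _ ω ω' e => by simp only [e, and_self]) hr
    have hregret := h.integral_regret_le hmin.1 hmin.2.1
    have hviol := h.integral_violation_le
    have hZ0 : 0 ≤ (τ : ℝ) ^ 2 / ((m : ℝ) * √(m : ℝ) * √(T : ℝ)) := by positivity
    refine ⟨hregret.mono hR1, hviol.mono hV1, ?_, ?_⟩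
    -- The losses have bounded gradients but need not be bounded uniformly over instances.
    -- Subtracting the value at `xsharp` makes them bounded by `F R`, and the sum of observed
    -- differences is the regret.
    · have hφB : ∀ y ∈ X, ∀ s, |f y s - f xsharp s| ≤ F * R := fun y hy s => by
        have a1 := (hf s).sub_le (fun y hy => hf' y hy s) hy hmin.1
        have a2 := (hf s).sub_le (fun y hy => hf' y hy s) hmin.1 hy
        have a3 := mul_le_mul_of_nonneg_left (hΦ.norm_sub_le hR.le hy hmin.1) hF.le
        rw [norm_sub_rev] at a2
        exact abs_le.2 ⟨by linarith, by linarith⟩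
      have key := h.integral_mean_average_le (φ := fun y s => f y s - f xsharp s) (φ' := f') hF.le
        c3.le (fun s => (hf s).sub_const _) hf' hφB (by
          simpa only [Finset.sum_sub_distrib] using hregret.2)
      have e : ∀ y, EDPP.mean π (fun s => f y s - f xsharp s)
          = EDPP.mean π (f y) - EDPP.mean π (f xsharp) := fun y => by
        simp only [EDPP.mean, mul_sub, Finset.sum_sub_distrib]
      simp only [e] at key
      refine key.mono ?_
      rw [EDPP.rpow_three_halves hm0]
      -- The first summand of the rate already suffices; the other is only nonnegative slack.
      refine mul_le_mul ?_ (le_add_of_nonneg_right (by positivity)) hZ0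
        (by unfold EDPP.totalConst; positivity)
      rw [EDPP.totalConst]
      nlinarith [mul_pos hG c1]
    · have key := h.integral_mean_average_le hG.le c2.le hg hg' hgH hviol.2
      refine key.mono ?_
      rw [EDPP.rpow_three_halves hm0]
      have hrest : 0 ≤ (τ : ℝ) ^ (5 / 2 : ℝ) / ((m : ℝ) * √(m : ℝ) * (T : ℝ))
          + (τ : ℝ) ^ 2 / ((m : ℝ) ^ (1 / 2 : ℝ) * (T : ℝ) ^ (3 / 2 : ℝ)) := by positivity
      refine mul_le_mul ?_ (by rw [add_assoc]; exact le_add_of_nonneg_right hrest) hZ0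
        (by unfold EDPP.totalConst; positivity)
      rw [EDPP.totalConst]
      nlinarith [mul_pos hF hR, mul_pos hF c1]
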